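/- **Setting.** An injective (left-canonical) translation-invariant MPS tensor is a family $A=(A^s)_{s=1}^d$ of $\chi\times\chi$ complex matrices with $\sum_s (A^s)^\dagger A^s=\mathbb 1$, with a positive definite $\rho$ such that $\sum_s A^s\rho (A^s)^\dagger=\rho$, and such that the eigenvalue $1$ of the transfer matrix $\sum_s A^s\otimes (A^s)^*$ has a one-dimensional eigenspace while all its other eigenvalues have modulus $<1$. Its periodic state on $n$ sites is $|\psi_n\rangle=\sum \mathrm{Tr}(A^{s_1}\cdots A^{s_n})|s_1\ldots s_n\rangle$. Let $G_a,G_b$ be (discrete) abelian groups, $a,b\in\mathbb Z$, and $L\ge1$ with $g^{a^L}=g$ for all $g\in G_a$ and $g^{b^L}=g$ for all $g\in G_b$ (periodic boundary conditions). Let $U$ be a unitary linear representation of $G_a\times G_b$ on the on-site space $\mathbb C^d$, and consider the two exponential symmetries $\mathcal U_{g_a}=\bigotimes_{j=1}^L U_{g_a}^{a^{j-1}}$, $\mathcal U_{g_b}=\bigotimes_{j=1}^L U_{g_b}^{b^{j-1}}$. The MPS is called symmetric if for every $k\ge1$ the state $|\psi_{kL}\rangle$ is an eigenstate, with eigenvalue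 a phase, of the $k$-fold periodic extension of $\mathcal U_{g_a}\mathcal U_{g_b}$, for all $g_a,g_b$. Bond unitaries are unitary $\chi\times\chi$ matrices $v_j(g)$, $g=(g_a,g_b)$, $j\in\mathbb Z/L$, with $(U_{g_a}^{a^{j-1}}U_{g_b}^{b^{j-1}})\cdot A = (\text{phase})\; v_{j-1}(g)^\dagger A\, v_j(g)$ for $1\le j\le L$. **(1) Cocycle constraints.** For every symmetric injective MPS, bond unitaries exist. There is one class $c\in H^2(G_a\times G_b,U(1))$ such that for every choice of bond unitaries and every bond $j$, $v_j(g)v_j(h)=\omega_j(g,h)\,v_j(gh)$ with a $2$-cocycle $\omega_j$ of class $c$. Let $\omega_a$, $\omega_b$ be the restrictions of $\omega_j$ to $G_a$, $G_b$, and let $\phi=\omega_j/(\mathrm{pr}_a^*\omega_a\cdot \mathrm{pr}_b^*\omega_b)$ be its mixed part. Then, up to coboundaries, $$\omega_a^{a^2-1}=1,\qquad \phi^{ab-1}=1,\qquad \omega_b^{b^2-1}=1,$$ and in particular the coboundary-invariant phase $\omega_j(g_a,g_b)\,\omega_j(g_b,g_a)^{-1}$ has $(ab-1)$-st power $1$ for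 all $g_a\in G_a$, $g_b\in G_b$. **(2) Charge plus exponential symmetry.** Let $G_a=G_b=\mathbb Z_N$ ($N\ge1$), $a=1$, and let $L\ge1$ satisfy $b^L\equiv 1 \pmod N$. Then every $U(1)$-valued $2$-cocycle on $\mathbb Z_N$ is a coboundary, and there is an isomorphism $H^2(\mathbb Z_N\times\mathbb Z_N,U(1))\cong\mathbb Z_N$, $[\omega]\mapsto k$, characterized by $\omega(g_a,g_b)\,\omega(g_b,g_a)^{-1}=\exp(2\pi i k g_ag_b/N)$ for $g_a,g_b\in\mathbb{Z}_N$. A class is carried by the bond unitaries of some symmetric injective MPS (for some $d$, $\chi$ and on-site linear representation $U$) if and only if $k$ is a multiple of $N/\gcd(b-1,N)$. The set of these classes, which are the (strong) SPT phases protected by the charge and exponential symmetries, is a subgroup isomorphic to $\mathbb Z_{\gcd(b-1,N)}$. -/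

import Mathlib

noncomputable section

namespace ModulatedMPS

open Matrix
open scoped Kronecker ComplexOrder

/-! ## Second group cohomology with coefficients in `U(1)` (trivial action) -/

/-- `U(1)`-valued 2-cocycles on `G`. -/
def Z2 (G : Type*) [Group G] : Subgroup (G → G → Circle) where
  carrier := {ω | ∀ g h k, ω g h * ω (g * h) k = ω h k * ω g (h * k)}
  one_mem' := by intro g h k; simp
  mul_mem' := by
    intro x y hx hy g h k
    simp only [Pi.mul_apply]
    rw [mul_mul_mul_comm, hx g h k, hy g h k, mul_mul_mul_comm]
  inv_mem' := by
    intro x hx g h k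
    simp only [Pi.inv_apply]
    rw [← mul_inv, hx g h k, mul_inv]

/-- `U(1)`-valued 2-coboundaries on `G`. -/
def B2 (G : Type*) [Group G] : Subgroup (G → G → Circle) where
  carrier := {ω | ∃ β : G → Circle, ∀ g h, ω g h = β g * β h / β (g * h)}
  one_mem' := ⟨fun _ => 1, by intro g h; simp⟩
  mul_mem' := by
    rintro x y ⟨β, hβ⟩ ⟨γ, hγ⟩
    refine ⟨fun g => β g * γ g, fun g h => ?_⟩
    simp only [Pi.mul_apply]
    rw [hβ, hγ, div_mul_div_comm, mul_mul_mul_comm]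
  inv_mem' := by
    rintro x ⟨β, hβ⟩
    refine ⟨fun g => (β g)⁻¹, fun g h => ?_⟩
    simp only [Pi.inv_apply]
    rw [hβ, inv_div, div_eq_mul_inv, div_eq_mul_inv, inv_inv, mul_inv, mul_comm]

/-- The group `H²(G, U(1))`: cocycles modulo coboundaries. -/
abbrev H2 (G : Type*) [Group G] : Type _ := Z2 G ⧸ (B2 G).subgroupOf (Z2 G)

/-- The cohomology class of a 2-cocycle. -/
def H2.mk {G : Type*} [Group G] (ω : Z2 G) : H2 G := QuotientGroup.mk ω

/-- `ω` is the factor system of the family `v`, i.e. `v g * v h = ω(g,h) v (g h)`. -/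
def IsFactorSystem {G : Type*} [Group G] {χ : ℕ}
    (v : G → unitaryGroup (Fin χ) ℂ) (ω : G → G → Circle) : Prop :=
  ∀ g h, (v g * v h : Matrix (Fin χ) (Fin χ) ℂ)
    = (ω g h : ℂ) • (v (g * h) : Matrix (Fin χ) (Fin χ) ℂ)

section Sectors

variable {Ga Gb : Type*} [Group Ga] [Group Gb]

/-- The `a-a` sector `ω_a(g_a, h_a)` of a function of two variables on `Ga × Gb`. -/
def sectorA (ω : Ga × Gb → Ga × Gb → Circle) : Ga → Ga → Circle :=
  fun g h => ω (g, 1) (h, 1)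

/-- The `b-b` sector `ω_b(g_b, h_b)`. -/
def sectorB (ω : Ga × Gb → Ga × Gb → Circle) : Gb → Gb → Circle :=
  fun g h => ω (1, g) (1, h)

/-- The mixed `a-b` sector, as a 2-cocycle on `Ga × Gb`: what is left of `ω` after the pull-backs
of its `a-a` and `b-b` sectors along the two projections have been divided out. -/
def sectorMixed (ω : Ga × Gb → Ga × Gb → Circle) : Ga × Gb → Ga × Gb → Circle :=
  fun g h => ω g h / (sectorA ω g.1 h.1 * sectorB ω g.2 h.2)

/-- The coboundary-invariant phase `φ(g_a, g_b) φ(g_b, g_a)⁻¹` of the mixed sector. -/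
def mixedPhase (ω : Ga × Gb → Ga × Gb → Circle) (ga : Ga) (gb : Gb) : Circle :=
  ω (ga, 1) (1, gb) / ω (1, gb) (ga, 1)

end Sectors

/-! ## Translation-invariant matrix product states -/

section MPS

variable {d χ : ℕ}

/-- The transfer matrix `∑ₛ Aˢ ⊗ (Aˢ)*`. -/
def transferMatrix (A : Fin d → Matrix (Fin χ) (Fin χ) ℂ) :
    Matrix (Fin χ × Fin χ) (Fin χ × Fin χ) ℂ :=
  ∑ s, A s ⊗ₖ (A s).map (starRingEnd ℂ)

/-- A left-canonical injective MPS tensor: the identity is a left fixed point of the transfer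
matrix, there is a positive definite right fixed point `ρ`, and the dominant eigenvalue `1` of the
transfer matrix has a unique eigenvector and is separated from all other eigenvalues by a gap. -/
structure IsInjectiveMPS (A : Fin d → Matrix (Fin χ) (Fin χ) ℂ) : Prop where
  left_canonical : ∑ s, (A s)ᴴ * A s = 1
  right_fixed : ∃ ρ : Matrix (Fin χ) (Fin χ) ℂ, ρ.PosDef ∧ ∑ s, A s * ρ * (A s)ᴴ = ρ
  unique_dominant :
    Module.finrank ℂ (Module.End.eigenspace (Matrix.toLin' (transferMatrix A)) 1) = 1
  gap : ∀ μ : ℂ, Module.End.HasEigenvalue (Matrix.toLin' (transferMatrix A)) μ → μ ≠ 1 → ‖μ‖ < 1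

/-- The periodic MPS on `n` sites: the amplitude of the configuration `s` is
`Tr (A^{s₁} ⋯ A^{sₙ})`. -/
def mpsState (A : Fin d → Matrix (Fin χ) (Fin χ) ℂ) (n : ℕ) (s : Fin n → Fin d) : ℂ :=
  (List.ofFn fun i => A (s i)).prod.trace

/-- The state `ψ` on `n` sites satisfies `(W₁ ⊗ ⋯ ⊗ Wₙ) ψ = e^{iθ} ψ` for some phase. -/
def IsTensorEigenstate {n : ℕ} (W : Fin n → unitaryGroup (Fin d) ℂ)
    (ψ : (Fin n → Fin d) → ℂ) : Prop :=
  ∃ θ : Circle, ∀ s : Fin n → Fin d,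
    ∑ s' : Fin n → Fin d, (∏ i, (W i : Matrix (Fin d) (Fin d) ℂ) (s i) (s' i)) * ψ s'
      = (θ : ℂ) * ψ s

/-- Bond unitaries on a ring of `L` sites, for a family `W` of on-site unitaries labelled by `G`:
`W_i(g) · A ≐ v_i(g)† A v_{i+1}(g)` at every site `i`, where `≐` is equality up to a phase.
Site `i` lies between bond `i` (on its left) and bond `i + 1` (on its right), and bond `L` is
bond `0`. -/
def IsBondUnitaries {G : Type*} {L : ℕ} [NeZero L] (A : Fin d → Matrix (Fin χ) (Fin χ) ℂ)
    (W : Fin L → G → unitaryGroup (Fin d) ℂ) (v : Fin L → G → unitaryGroup (Fin χ) ℂ) : Prop :=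
  ∀ (i : Fin L) (g : G), ∃ θ : Circle, ∀ s : Fin d,
    ∑ s' : Fin d, (W i g : Matrix (Fin d) (Fin d) ℂ) s s' • A s'
      = (θ : ℂ) • ((v i g : Matrix (Fin χ) (Fin χ) ℂ)ᴴ * A s
          * (v (i + 1) g : Matrix (Fin χ) (Fin χ) ℂ))

end MPS

/-! ## Two exponential symmetries -/

section Exponential

variable {Ga Gb : Type*} [Group Ga] [Group Gb] {d χ : ℕ}

/-- The on-site unitary `U_{g_a}^{a^j} U_{g_b}^{b^j}` of `𝒰_{g_a} 𝒰_{g_b}` at the site with index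
`j` (sites are counted from `0`). -/
def siteUnitary (U : Ga × Gb →* unitaryGroup (Fin d) ℂ) (a b : ℤ) (j : ℕ) (g : Ga × Gb) :
    unitaryGroup (Fin d) ℂ :=
  U (g.1, 1) ^ (a ^ j) * U (1, g.2) ^ (b ^ j)

/-- For every `k ≥ 1`, the MPS on `k L` sites is an eigenstate of the `k`-fold periodic extension
of each of the modulated symmetry operators on `L` sites. -/
def IsSymmetricMPS (A : Fin d → Matrix (Fin χ) (Fin χ) ℂ)
    (U : Ga × Gb →* unitaryGroup (Fin d) ℂ) (a b : ℤ) (L : ℕ) : Prop :=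
  ∀ (g : Ga × Gb) (k : ℕ), 0 < k →
    IsTensorEigenstate (fun i : Fin (k * L) => siteUnitary U a b (i.val % L) g)
      (mpsState A (k * L))

/-- The (strong) SPT classes of two exponential symmetries on chains with an `L`-site unit cell:
the classes in `H²(Ga × Gb, U(1))` carried by the bond unitaries of symmetric injective
translation-invariant MPS whose sites carry linear representations of `Ga × Gb`. -/
def sptClasses (Ga Gb : Type*) [Group Ga] [Group Gb] (a b : ℤ) (L : ℕ) [NeZero L] :
    Set (H2 (Ga × Gb)) :=
  {c | ∃ (d χ : ℕ) (A : Fin d → Matrix (Fin χ) (Fin χ) ℂ)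
      (U : Ga × Gb →* unitaryGroup (Fin d) ℂ),
      IsInjectiveMPS A ∧ IsSymmetricMPS A U a b L ∧
      ∃ v : Fin L → Ga × Gb → unitaryGroup (Fin χ) ℂ,
        IsBondUnitaries A (fun i g => siteUnitary U a b i.val g) v ∧
        ∀ i, ∃ ω : Z2 (Ga × Gb), IsFactorSystem (v i) ω.1 ∧ H2.mk ω = c}

end Exponential

end ModulatedMPS

end

/-!
For an injective tensor `A` the powers of the transfer matrix converge to a rank-one projection, so
the overlap of two periodic states on `kL` sites is governed by the transport around one unit cell
of the mixed transfer map of `A` and its image under the symmetry. If `|ψ_{kL}⟩` is an eigenstate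
for every `k`, this transport has an eigenvalue of modulus one, and the defect identity in the norm
weighted by `ρ` shows that its eigenvectors, transported along the ring, are multiples of unitaries:
these are the bond unitaries. They are unique up to phases, so their factor systems are cocycles.

Translating the chain by one site turns the bond unitaries `v_j(g)` into `v_{j+1}` evaluated at
`g_a ^ a, g_b ^ b`. Hence the class of the factor system is invariant under pull-back along the
modulation `(g_a, g_b) ↦ (g_a ^ a, g_b ^ b)`. A class on an abelian group is determined by its
bimultiplicative commutator pairing because `U(1)` is divisible, and invariance of this pairing
makes its restrictions to the sectors trivial to the powers `a ^ 2 - 1`, `a b - 1` and `b ^ 2 - 1`.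

Conversely, an invariant class with a projective representation `V` is carried by the tensor of
matrix units on `ℂⁿ ⊗ ℂⁿ`, on which `conj (V g) ⊗ V (τ g)`, with `τ` the modulation, acts linearly
after a rescaling. On `ℤ_N × ℤ_N` the Weyl matrices provide `V` for every class.
-/

noncomputable section

namespace ModulatedMPS

open Matrix Filter Topology
open scoped Kronecker ComplexOrder

section MatrixPowers

variable {n : Type*} [Fintype n] {M : Matrix n n ℂ} {u w : n → ℂ}

theorem isIdempotentElem_vecMulVec (hwu : w ⬝ᵥ u = 1) : IsIdempotentElem (vecMulVec u w) := by
  rw [IsIdempotentElem, vecMulVec_mul_vecMulVec, hwu, one_smul]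

theorem mulVec_eq_smul_of_sub_vecMulVec_mulVec_eq_smul (hw : w ᵥ* M = w) (hwu : w ⬝ᵥ u = 1)
    {x : n → ℂ} {μ : ℂ} (hμ : μ ≠ 0) (hx : (M - vecMulVec u w) *ᵥ x = μ • x) :
    w ⬝ᵥ x = 0 ∧ M *ᵥ x = μ • x := by
  have hwx : w ⬝ᵥ x = 0 := by
    have : μ • (w ⬝ᵥ x) = 0 := by
      rw [← dotProduct_smul, ← hx, dotProduct_mulVec, vecMul_sub, hw, vecMul_vecMulVec, hwu,
        one_smul, sub_self, zero_dotProduct]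
    simpa [hμ] using this
  exact ⟨hwx, by simpa [sub_mulVec, vecMulVec_mulVec, hwx] using hx⟩

variable [DecidableEq n]

theorem hasEigenvalue_toLin'_iff {μ : ℂ} :
    Module.End.HasEigenvalue (toLin' M) μ ↔ ∃ x, x ≠ 0 ∧ M *ᵥ x = μ • x := by
  constructor
  · intro h
    obtain ⟨x, hx⟩ := h.exists_hasEigenvector
    exact ⟨x, hx.2, hx.apply_eq_smul⟩
  · rintro ⟨x, hx0, hx⟩
    exact Module.End.hasEigenvalue_of_hasEigenvector
      ⟨Module.End.mem_eigenspace_iff.2 (by rwa [toLin'_apply]), hx0⟩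

attribute [local instance] Matrix.linftyOpNormedRing Matrix.linftyOpNormedAlgebra in
theorem tendsto_pow_zero_of_eigenvalues
    (h : ∀ μ : ℂ, Module.End.HasEigenvalue (toLin' M) μ → ‖μ‖ < 1) :
    Tendsto (M ^ ·) atTop (𝓝 0) := by
  have hradius : spectralRadius ℂ M < 1 := by
    rcases (spectrum ℂ M).eq_empty_or_nonempty with hempty | hne
    · simp [spectralRadius, hempty]
    · refine spectrum.spectralRadius_lt_of_forall_lt_of_nonempty hne (r := 1) fun μ hμ => ?_
      rw [← spectrum_toLin', ← Module.End.hasEigenvalue_iff_mem_spectrum] at hμ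
      exact_mod_cast h μ hμ
  obtain ⟨r, hr, hr1⟩ := exists_between hradius
  lift r to NNReal using (hr1.trans ENNReal.one_lt_top).ne
  have hgelfand := (spectrum.pow_nnnorm_pow_one_div_tendsto_nhds_spectralRadius M).eventually
    (gt_mem_nhds hr)
  refine tendsto_zero_iff_norm_tendsto_zero.2 <| squeeze_zero'
    (Eventually.of_forall fun _ => norm_nonneg _) ?_
    (tendsto_pow_atTop_nhds_zero_of_lt_one r.2 (by exact_mod_cast hr1))
  filter_upwards [hgelfand, eventually_gt_atTop 0] with k hk hk0
  have hroot := ENNReal.rpow_le_rpow hk.le (Nat.cast_nonneg (α := ℝ) k)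
  rw [← ENNReal.rpow_mul, one_div, inv_mul_cancel₀ (by positivity), ENNReal.rpow_one,
    ENNReal.rpow_natCast] at hroot
  exact_mod_cast hroot

theorem sub_pow_succ_of_isIdempotentElem {R : Type*} [Ring R] {x p : R}
    (hp : IsIdempotentElem p) (hxp : x * p = p) (hpx : p * x = p) (k : ℕ) :
    (x - p) ^ (k + 1) = x ^ (k + 1) - p := by
  have hp_pow : ∀ j, p * x ^ j = p := fun j => by
    induction j with
    | zero => simp
    | succ j ih => rw [pow_succ, ← mul_assoc, ih, hpx]
  induction k with
  | zero => simp
  | succ k ih =>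
    rw [pow_succ', ih, sub_mul, mul_sub, mul_sub, hxp, hp.eq, hp_pow, ← pow_succ', sub_self,
      sub_zero]

theorem tendsto_pow_vecMulVec (hu : M *ᵥ u = u) (hw : w ᵥ* M = w) (hwu : w ⬝ᵥ u = 1)
    (hsimple : Module.finrank ℂ (Module.End.eigenspace (toLin' M) 1) = 1)
    (hgap : ∀ μ : ℂ, Module.End.HasEigenvalue (toLin' M) μ → μ ≠ 1 → ‖μ‖ < 1) :
    Tendsto (M ^ ·) atTop (𝓝 (vecMulVec u w)) := by
  have hdeflated : Tendsto ((M - vecMulVec u w) ^ ·) atTop (𝓝 0) := by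
    refine tendsto_pow_zero_of_eigenvalues fun μ hμ => ?_
    obtain ⟨x, hx0, hx⟩ := hasEigenvalue_toLin'_iff.1 hμ
    rcases eq_or_ne μ 0 with rfl | hμ0
    · simp
    obtain ⟨hwx, hMx⟩ := mulVec_eq_smul_of_sub_vecMulVec_mulVec_eq_smul hw hwu hμ0 hx
    refine hgap μ (hasEigenvalue_toLin'_iff.2 ⟨x, hx0, hMx⟩) ?_
    rintro rfl
    have hu_mem : u ∈ Module.End.eigenspace (toLin' M) 1 := by simpa using hu
    have hu0 : (⟨u, hu_mem⟩ : Module.End.eigenspace (toLin' M) 1) ≠ 0 := by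
      rintro h
      simp [show u = 0 from congrArg Subtype.val h] at hwu
    obtain ⟨c, hc⟩ := (finrank_eq_one_iff_of_nonzero' _ hu0).1 hsimple ⟨x, by simpa using hMx⟩
    obtain rfl : c • u = x := congrArg Subtype.val hc
    simp_all
  have hpow : ∀ k, (M - vecMulVec u w) ^ (k + 1) + vecMulVec u w = M ^ (k + 1) := fun k => by
    rw [sub_pow_succ_of_isIdempotentElem (isIdempotentElem_vecMulVec hwu)
      (by rw [mul_vecMulVec, hu]) (by rw [vecMulVec_mul, hw]), sub_add_cancel]
  rw [← tendsto_add_atTop_iff_nat 1]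
  simpa only [hpow, zero_add] using
    ((tendsto_add_atTop_iff_nat 1).2 hdeflated).add_const (vecMulVec u w)

theorem finrank_eigenspace_vecMulVec (hwu : w ⬝ᵥ u = 1) :
    Module.finrank ℂ (Module.End.eigenspace (toLin' (vecMulVec u w)) 1) = 1 := by
  have hmem : ∀ x, x ∈ Module.End.eigenspace (toLin' (vecMulVec u w)) 1 ↔ (w ⬝ᵥ x) • u = x := by
    simp [vecMulVec_mulVec]
  have hu : (⟨u, (hmem u).2 (by rw [hwu, one_smul])⟩ :
      Module.End.eigenspace (toLin' (vecMulVec u w)) 1) ≠ 0 := by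
    intro h
    simp [show u = 0 from congrArg Subtype.val h] at hwu
  exact finrank_eq_one _ hu fun x => ⟨w ⬝ᵥ x.1, Subtype.ext ((hmem x).1 x.2)⟩

theorem eigenvalue_vecMulVec_mem (hwu : w ⬝ᵥ u = 1) {μ : ℂ}
    (hμ : Module.End.HasEigenvalue (toLin' (vecMulVec u w)) μ) : μ = 0 ∨ μ = 1 := by
  rw [Module.End.hasEigenvalue_iff_mem_spectrum, spectrum_toLin'] at hμ
  exact (isIdempotentElem_vecMulVec hwu).spectrum_subset ℂ hμ

end MatrixPowers

section OrderedProducts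

variable {n : ℕ}

theorem prod_ofFn_sum {R σ : Type*} [Semiring R] [Fintype σ] (f : Fin n → σ → R) :
    (List.ofFn fun i => ∑ s, f i s).prod =
      ∑ s : Fin n → σ, (List.ofFn fun i => f i (s i)).prod := by
  classical simpa using (MultilinearMap.mkPiAlgebraFin ℕ n R).map_sum f

theorem prod_ofFn_smul {S R : Type*} [CommSemiring S] [Semiring R] [Algebra S R]
    (c : Fin n → S) (f : Fin n → R) :
    (List.ofFn fun i => c i • f i).prod = (∏ i, c i) • (List.ofFn f).prod := by
  simpa using (MultilinearMap.mkPiAlgebraFin S n R).map_smul_univ c f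

theorem prod_ofFn_kronecker {R l m : Type*} [CommSemiring R] [Fintype l] [Fintype m]
    [DecidableEq l] [DecidableEq m] (f : Fin n → Matrix l l R) (g : Fin n → Matrix m m R) :
    (List.ofFn fun i => f i ⊗ₖ g i).prod = (List.ofFn f).prod ⊗ₖ (List.ofFn g).prod := by
  induction n with
  | zero => simp
  | succ n ih => simp only [List.ofFn_succ, List.prod_cons, ih, mul_kronecker_mul]

theorem prod_ofFn_map {R S m : Type*} [Semiring R] [Semiring S] [Fintype m] [DecidableEq m]
    (φ : R →+* S) (f : Fin n → Matrix m m R) :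
    (List.ofFn fun i => (f i).map φ).prod = (List.ofFn f).prod.map φ := by
  simpa [List.map_ofFn, Function.comp_def] using (map_list_prod φ.mapMatrix (List.ofFn f)).symm

theorem prod_ofFn_const {R : Type*} [Monoid R] (x : R) :
    (List.ofFn fun _ : Fin n => x).prod = x ^ n := by
  simp [List.ofFn_const]

theorem prod_ofFn_mod {R : Type*} [Monoid R] {L : ℕ} [NeZero L] (k : ℕ) (f : ℕ → R) :
    (List.ofFn fun i : Fin (k * L) => f (i % L)).prod
      = (List.ofFn fun i : Fin L => f i).prod ^ k := by
  have hmod : ∀ (i : Fin k) (j : Fin L), (i.val * L + j.val) % L = j.val := fun i j => by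
    rw [Nat.mul_add_mod_of_lt j.2]
  simp [List.ofFn_mul, List.prod_flatten, hmod, List.ofFn_const]

end OrderedProducts

section TransferMaps

variable {σ m n : Type*} [Fintype σ]

/-- The tensor `W · A` obtained from `A` by acting with `W` on the physical index. -/
def siteAct (W : Matrix σ σ ℂ) (A : σ → Matrix m m ℂ) (s : σ) : Matrix m m ℂ :=
  ∑ s', W s s' • A s'

theorem siteAct_smul (W : Matrix σ σ ℂ) (c : ℂ) (A : σ → Matrix m m ℂ) (s : σ) :
    siteAct W (fun s => c • A s) s = c • siteAct W A s := by
  simp only [siteAct, Finset.smul_sum]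
  exact Finset.sum_congr rfl fun _ _ => smul_comm _ _ _

theorem siteAct_mul_mul [Fintype m] (W : Matrix σ σ ℂ) (X Y : Matrix m m ℂ)
    (A : σ → Matrix m m ℂ) (s : σ) :
    siteAct W (fun s => X * A s * Y) s = X * siteAct W A s * Y := by
  simp [siteAct, Finset.mul_sum, Finset.sum_mul]

theorem siteAct_siteAct (W V : Matrix σ σ ℂ) (A : σ → Matrix m m ℂ) (s : σ) :
    siteAct W (siteAct V A) s = siteAct (W * V) A s := by
  simp only [siteAct, Finset.smul_sum, Matrix.mul_apply, Finset.sum_smul, smul_smul]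
  rw [Finset.sum_comm]

/-- The mixed transfer matrix `∑ₛ Bˢ ⊗ (Aˢ)*` of two tensors. -/
def mixedTransfer (B : σ → Matrix n n ℂ) (A : σ → Matrix m m ℂ) :
    Matrix (n × m) (n × m) ℂ :=
  ∑ s, B s ⊗ₖ (A s).map (starRingEnd ℂ)

theorem mixedTransfer_siteAct_self [DecidableEq σ] (W : unitaryGroup σ ℂ)
    (A : σ → Matrix m m ℂ) :
    mixedTransfer (siteAct W.1 A) (siteAct W.1 A) = mixedTransfer A A := by
  have hW : ∀ x y : σ → ℂ, (W.1 *ᵥ x) ⬝ᵥ star (W.1 *ᵥ y) = x ⬝ᵥ star y := fun x y => by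
    rw [star_mulVec, dotProduct_comm, ← dotProduct_mulVec, mulVec_mulVec,
      ← star_eq_conjTranspose, Unitary.coe_star_mul_self, one_mulVec, dotProduct_comm]
  ext ⟨i, k⟩ ⟨j, l⟩
  simpa [mixedTransfer, siteAct, Matrix.sum_apply, dotProduct, mulVec] using
    hW (fun s => A s i j) (fun s => A s k l)

variable [Fintype m] [Fintype n]

/-- The map `Y ↦ ∑ₛ (Aˢ)† Y Bˢ`, which is the transposed mixed transfer matrix read as a map on
matrices. -/
def dualTransfer (A : σ → Matrix m m ℂ) (B : σ → Matrix n n ℂ) :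
    Module.End ℂ (Matrix m n ℂ) where
  toFun Y := ∑ s, (A s)ᴴ * Y * B s
  map_add' := by simp [Matrix.mul_add, Matrix.add_mul, Finset.sum_add_distrib]
  map_smul' := by simp [Finset.smul_sum]

theorem dualTransfer_apply (A : σ → Matrix m m ℂ) (B : σ → Matrix n n ℂ) (Y : Matrix m n ℂ) :
    dualTransfer A B Y = ∑ s, (A s)ᴴ * Y * B s :=
  rfl

theorem vec_dualTransfer (A : σ → Matrix m m ℂ) (B : σ → Matrix n n ℂ) (Y : Matrix m n ℂ) :
    vec (dualTransfer A B Y) = (mixedTransfer B A)ᵀ *ᵥ vec Y := by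
  simp only [mixedTransfer, dualTransfer_apply, transpose_sum, sum_mulVec, vec_sum]
  refine Finset.sum_congr rfl fun s _ => ?_
  rw [← kroneckerMap_transpose, kronecker_mulVec_vec, transpose_transpose]
  rfl

theorem mixedTransfer_mulVec_vec (B : σ → Matrix n n ℂ) (A : σ → Matrix m m ℂ)
    (Y : Matrix m n ℂ) :
    mixedTransfer B A *ᵥ vec Y = vec (∑ s, (A s).map (starRingEnd ℂ) * Y * (B s)ᵀ) := by
  simp [mixedTransfer, sum_mulVec, kronecker_mulVec_vec, vec_sum]

theorem dualTransfer_siteAct_self [DecidableEq σ] (W : unitaryGroup σ ℂ) (A : σ → Matrix m m ℂ) :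
    dualTransfer (siteAct W.1 A) (siteAct W.1 A) = dualTransfer A A :=
  LinearMap.ext fun Y => by
    rw [← vec_inj, vec_dualTransfer, mixedTransfer_siteAct_self, vec_dualTransfer]

/-- The composition of the first `k` dual transfer maps of `A` with a sequence `B` of tensors. -/
def transport (A : σ → Matrix m m ℂ) (B : ℕ → σ → Matrix n n ℂ) :
    ℕ → Module.End ℂ (Matrix m n ℂ)
  | 0 => 1
  | k + 1 => dualTransfer A (B k) * transport A B k

theorem transport_zero (A : σ → Matrix m m ℂ) (B : ℕ → σ → Matrix n n ℂ) (Y : Matrix m n ℂ) :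
    transport A B 0 Y = Y := rfl

theorem transport_const (A : σ → Matrix m m ℂ) (B : σ → Matrix n n ℂ) (k : ℕ) :
    transport A (fun _ => B) k = dualTransfer A B ^ k := by
  induction k with
  | zero => rfl
  | succ k ih => rw [transport, ih, pow_succ']

theorem vec_transport [DecidableEq m] [DecidableEq n] (A : σ → Matrix m m ℂ)
    (B : ℕ → σ → Matrix n n ℂ) (Y : Matrix m n ℂ) (k : ℕ) :
    vec (transport A B k Y)
      = (List.ofFn fun i : Fin k => mixedTransfer (B i) A).prodᵀ *ᵥ vec Y := by
  induction k with
  | zero => simp [transport]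
  | succ k ih =>
    rw [transport, Module.End.mul_apply, vec_dualTransfer, ih, mulVec_mulVec, ← transpose_mul,
      List.ofFn_succ', List.concat_eq_append, List.prod_append, List.prod_singleton]
    simp

theorem vec_dualTransfer_pow [DecidableEq m] (A : σ → Matrix m m ℂ) (Y : Matrix m m ℂ) (k : ℕ) :
    vec ((dualTransfer A A ^ k) Y) = (mixedTransfer A A ^ k)ᵀ *ᵥ vec Y := by
  rw [← transport_const, vec_transport, prod_ofFn_const]

end TransferMaps

section InjectiveTensors

variable {d χ : ℕ} {A : Fin d → Matrix (Fin χ) (Fin χ) ℂ}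

theorem IsInjectiveMPS.nonempty (hA : IsInjectiveMPS A) : Nonempty (Fin χ) := by
  by_contra hempty
  rw [not_nonempty_iff] at hempty
  simpa [Module.finrank_zero_of_subsingleton] using hA.unique_dominant

theorem IsInjectiveMPS.exists_ne_zero (hA : IsInjectiveMPS A) : ∃ s, A s ≠ 0 := by
  by_contra! hzero
  have := hA.nonempty
  simpa [hzero] using hA.left_canonical

theorem IsInjectiveMPS.exists_right_fixed_trace_one (hA : IsInjectiveMPS A) :
    ∃ ρ : Matrix (Fin χ) (Fin χ) ℂ, ρ.PosDef ∧ ∑ s, A s * ρ * (A s)ᴴ = ρ ∧ ρ.trace = 1 := by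
  obtain ⟨ρ, hρ, hfix⟩ := hA.right_fixed
  have := hA.nonempty
  have htrace : 0 < ρ.trace := hρ.trace_pos
  refine ⟨ρ.trace⁻¹ • ρ, hρ.smul (inv_pos.2 htrace), ?_, ?_⟩
  · simp only [mul_smul_comm, smul_mul_assoc, ← Finset.smul_sum, hfix]
  · rw [trace_smul, smul_eq_mul, inv_mul_cancel₀ htrace.ne']

theorem IsInjectiveMPS.exists_tendsto_transferMatrix_pow (hA : IsInjectiveMPS A) :
    ∃ ρ : Matrix (Fin χ) (Fin χ) ℂ, ρ.trace = 1 ∧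
      Tendsto (transferMatrix A ^ ·) atTop (𝓝 (vecMulVec (vec ρᵀ) (vec 1))) := by
  obtain ⟨ρ, -, hfix, htrace⟩ := hA.exists_right_fixed_trace_one
  refine ⟨ρ, htrace, tendsto_pow_vecMulVec ?_ ?_ ?_ hA.unique_dominant hA.gap⟩
  · conv_rhs => rw [← hfix]
    change mixedTransfer A A *ᵥ _ = _
    simp only [mixedTransfer_mulVec_vec, transpose_sum, transpose_mul, Matrix.mul_assoc]
    rfl
  · rw [← mulVec_transpose]
    change (mixedTransfer A A)ᵀ *ᵥ _ = _
    rw [← vec_dualTransfer, dualTransfer_apply]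
    simp [hA.left_canonical]
  · simp [vec_dotProduct_vec, htrace]

theorem IsInjectiveMPS.tendsto_trace_transferMatrix_pow (hA : IsInjectiveMPS A) :
    Tendsto (fun k => (transferMatrix A ^ k).trace) atTop (𝓝 1) := by
  obtain ⟨ρ, htrace, hlim⟩ := hA.exists_tendsto_transferMatrix_pow
  have hlim_trace := ((continuous_id.matrix_trace).tendsto _).comp hlim
  simpa [Function.comp_def, trace_vecMulVec, vec_dotProduct_vec, htrace] using hlim_trace

theorem IsInjectiveMPS.exists_tendsto_dualTransfer_pow (hA : IsInjectiveMPS A)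
    (X : Matrix (Fin χ) (Fin χ) ℂ) :
    ∃ t : ℂ, Tendsto (fun k => (dualTransfer A A ^ k) X) atTop (𝓝 (t • 1)) := by
  obtain ⟨ρ, -, hlim⟩ := hA.exists_tendsto_transferMatrix_pow
  refine ⟨vec ρᵀ ⬝ᵥ vec X, ?_⟩
  have hcont : Continuous fun M : Matrix (Fin χ × Fin χ) (Fin χ × Fin χ) ℂ =>
      Matrix.of fun i j => (Mᵀ *ᵥ vec X) (j, i) := by
    fun_prop
  convert (hcont.tendsto _).comp hlim using 2 with k
  · exact Matrix.ext fun i j => congrFun (vec_dualTransfer_pow A X k) (j, i)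
  · ext i j
    simp [transpose_vecMulVec, vecMulVec_mulVec, mul_comm, vec]

theorem IsInjectiveMPS.eq_smul_one_of_dualTransfer_pow (hA : IsInjectiveMPS A) {L : ℕ} [NeZero L]
    {X : Matrix (Fin χ) (Fin χ) ℂ} {θ : Circle}
    (hX : (dualTransfer A A ^ L) X = (θ : ℂ) • X) : ∃ z : ℂ, X = z • 1 := by
  have hpow : ∀ k, (dualTransfer A A ^ (L * k)) X = ((θ ^ k : Circle) : ℂ) • X := fun k => by
    induction k with
    | zero => simp
    | succ k ih => rw [Nat.mul_succ, pow_add, Module.End.mul_apply, hX, map_smul, ih, smul_smul,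
        ← Circle.coe_mul, pow_succ']
  obtain ⟨t, ht⟩ := hA.exists_tendsto_dualTransfer_pow X
  obtain ⟨z, φ, hφ, hz⟩ := CompactSpace.tendsto_subseq (θ ^ · : ℕ → Circle)
  have hlim_z : Tendsto (fun k => ((θ ^ φ k : Circle) : ℂ) • X) atTop (𝓝 ((z : ℂ) • X)) :=
    hz.smul_const X
  have hlim_t : Tendsto (fun k => ((θ ^ φ k : Circle) : ℂ) • X) atTop (𝓝 (t • 1)) := by
    simpa only [Function.comp_def, hpow, id] using
      ht.comp ((tendsto_id.const_mul_atTop' (NeZero.pos L)).comp hφ.tendsto_atTop)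
  refine ⟨(z : ℂ)⁻¹ * t, ?_⟩
  rw [mul_smul, ← tendsto_nhds_unique hlim_z hlim_t, inv_smul_smul₀ z.coe_ne_zero]

end InjectiveTensors

section Overlaps

variable {σ m n : Type*} [Fintype σ] [Fintype m] [Fintype n] [DecidableEq m] [DecidableEq n]

/-- The amplitudes `Tr (B₁^{s₁} ⋯ B_k^{s_k})` of the periodic matrix product state whose tensor
`Bᵢ` depends on the site. -/
def ringState {k : ℕ} (B : Fin k → σ → Matrix n n ℂ) (s : Fin k → σ) : ℂ :=
  (List.ofFn fun i => B i (s i)).prod.trace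

theorem sum_ringState_mul_conj_ringState {k : ℕ} (B : Fin k → σ → Matrix n n ℂ)
    (A : Fin k → σ → Matrix m m ℂ) :
    ∑ s, ringState B s * starRingEnd ℂ (ringState A s)
      = (List.ofFn fun i => mixedTransfer (B i) (A i)).prod.trace := by
  simp only [mixedTransfer, prod_ofFn_sum, trace_sum, prod_ofFn_kronecker, trace_kronecker,
    prod_ofFn_map, ringState, AddMonoidHom.map_trace]

theorem sum_prod_mul_ringState {k : ℕ} (W : Fin k → Matrix σ σ ℂ)
    (A : Fin k → σ → Matrix n n ℂ) (s : Fin k → σ) :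
    ∑ s', (∏ i, W i (s i) (s' i)) * ringState A s'
      = ringState (fun i => siteAct (W i) (A i)) s := by
  simp only [ringState, siteAct, prod_ofFn_sum, trace_sum, prod_ofFn_smul, trace_smul, smul_eq_mul]

theorem exists_eigenvector_of_not_tendsto_trace_pow {M : Matrix n n ℂ}
    (hM : ¬ Tendsto (fun k => (M ^ k).trace) atTop (𝓝 0)) :
    ∃ (μ : ℂ) (x : n → ℂ), 1 ≤ ‖μ‖ ∧ x ≠ 0 ∧ M *ᵥ x = μ • x := by
  contrapose! hM
  have hpow := tendsto_pow_zero_of_eigenvalues (M := M) fun μ hμ => by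
    obtain ⟨x, hx0, hx⟩ := hasEigenvalue_toLin'_iff.1 hμ
    exact not_le.1 fun h => hM μ x h hx0 hx
  simpa [Function.comp_def] using ((continuous_id.matrix_trace).tendsto _).comp hpow

variable {d χ : ℕ} {A : Fin d → Matrix (Fin χ) (Fin χ) ℂ}

theorem norm_trace_prod_mixedTransfer_pow {L : ℕ} [NeZero L]
    {B : ℕ → Fin d → Matrix (Fin χ) (Fin χ) ℂ} {k : ℕ} {θ : Circle}
    (hθ : ∀ s, ringState (fun i : Fin (k * L) => B (i % L)) s = θ * mpsState A (k * L) s) :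
    ‖((List.ofFn fun i : Fin L => mixedTransfer (B i) A).prod ^ k).trace‖
      = ‖(transferMatrix A ^ (k * L)).trace‖ := by
  have hBA := sum_ringState_mul_conj_ringState (fun i : Fin (k * L) => B (i % L)) fun _ => A
  have hAA := sum_ringState_mul_conj_ringState (fun _ : Fin (k * L) => A) fun _ => A
  rw [prod_ofFn_mod k fun i => mixedTransfer (B i) A] at hBA
  rw [prod_ofFn_const] at hAA
  simp only [hθ, mul_assoc, ← Finset.mul_sum] at hBA
  rw [← hBA, norm_mul, Circle.norm_coe, one_mul]
  exact congrArg norm hAA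

theorem IsInjectiveMPS.exists_transport_eigenvector (hA : IsInjectiveMPS A) {L : ℕ} [NeZero L]
    {B : ℕ → Fin d → Matrix (Fin χ) (Fin χ) ℂ}
    (hB : ∀ k, 0 < k → ∃ θ : Circle, ∀ s,
      ringState (fun i : Fin (k * L) => B (i % L)) s = θ * mpsState A (k * L) s) :
    ∃ (μ : ℂ) (Y : Matrix (Fin χ) (Fin χ) ℂ),
      1 ≤ ‖μ‖ ∧ Y ≠ 0 ∧ transport A B L Y = μ • Y := by
  set M := (List.ofFn fun i : Fin L => mixedTransfer (B i) A).prod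
  have hnot : ¬ Tendsto (fun k => (Mᵀ ^ k).trace) atTop (𝓝 0) := fun h0 => by
    have h1 := (hA.tendsto_trace_transferMatrix_pow.comp
      (tendsto_id.atTop_mul_const' (NeZero.pos L))).norm
    have heq : ∀ᶠ k : ℕ in atTop, ‖(transferMatrix A ^ (k * L)).trace‖ = ‖(Mᵀ ^ k).trace‖ := by
      filter_upwards [eventually_gt_atTop 0] with k hk
      obtain ⟨θ, hθ⟩ := hB k hk
      rw [← norm_trace_prod_mixedTransfer_pow hθ, ← transpose_pow, trace_transpose]
    simpa using tendsto_nhds_unique (h1.congr' heq) h0.norm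
  obtain ⟨μ, x, hμ, hx0, hx⟩ := exists_eigenvector_of_not_tendsto_trace_pow hnot
  obtain ⟨Y, rfl⟩ := vec_bijective.2 x
  exact ⟨μ, Y, hμ, by rintro rfl; simp at hx0, by rw [← vec_inj, vec_transport, vec_smul, hx]⟩

end Overlaps

section WeightedNorm

variable {σ m n : Type*} [Fintype σ] [Fintype m] [Fintype n]

/-- The squared norm `Tr (ρ Y† Y)` of a matrix, weighted by a positive matrix `ρ`. -/
def weightedNormSq (ρ : Matrix n n ℂ) (Y : Matrix m n ℂ) : ℝ :=
  (ρ * (Yᴴ * Y)).trace.re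

theorem weightedNormSq_smul (ρ : Matrix n n ℂ) (c : ℂ) (Y : Matrix m n ℂ) :
    weightedNormSq ρ (c • Y) = ‖c‖ ^ 2 * weightedNormSq ρ Y := by
  have hc : star c * c = ((‖c‖ ^ 2 : ℝ) : ℂ) := by
    rw [Complex.star_def, Complex.conj_mul', Complex.ofReal_pow]
  rw [weightedNormSq, conjTranspose_smul, Matrix.smul_mul, Matrix.mul_smul, Matrix.mul_smul,
    Matrix.mul_smul, smul_smul, hc, trace_smul, smul_eq_mul, Complex.re_ofReal_mul, weightedNormSq]

theorem trace_mul_conjTranspose_mul_self (ρ : Matrix n n ℂ) (Y : Matrix m n ℂ) :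
    (ρ * (Yᴴ * Y)).trace = (Y * ρ * Yᴴ).trace := by
  rw [← Matrix.mul_assoc, trace_mul_comm, Matrix.mul_assoc]

theorem weightedNormSq_nonneg {ρ : Matrix n n ℂ} (hρ : ρ.PosSemidef) (Y : Matrix m n ℂ) :
    0 ≤ weightedNormSq ρ Y := by
  rw [weightedNormSq, trace_mul_conjTranspose_mul_self]
  exact (Complex.le_def.1 (hρ.mul_mul_conjTranspose_same Y).trace_nonneg).1

open scoped MatrixOrder in
theorem eq_zero_of_weightedNormSq_eq_zero {ρ : Matrix n n ℂ} (hρ : ρ.PosDef) {Y : Matrix m n ℂ}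
    (hY : weightedNormSq ρ Y = 0) : Y = 0 := by
  classical
  have htrace := (hρ.posSemidef.mul_mul_conjTranspose_same Y).trace_nonneg
  rw [weightedNormSq, trace_mul_conjTranspose_mul_self] at hY
  have hzero : (Y * ρ * Yᴴ).trace = 0 := Complex.ext hY (Complex.le_def.1 htrace).2.symm
  obtain ⟨C, hC, rfl⟩ :=
    CStarAlgebra.isStrictlyPositive_iff_eq_star_mul_self.1 hρ.isStrictlyPositive
  have hfactor : Y * (star C * C) * Yᴴ = Y * Cᴴ * (Y * Cᴴ)ᴴ := by
    simp only [star_eq_conjTranspose, conjTranspose_mul, conjTranspose_conjTranspose,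
      Matrix.mul_assoc]
  rw [hfactor, trace_mul_conjTranspose_self_eq_zero_iff] at hzero
  have hdet : IsUnit Cᴴ.det := (isUnit_iff_isUnit_det _).1 hC.star
  rw [← mul_nonsing_inv_cancel_right _ Y hdet, hzero, Matrix.zero_mul]

theorem trace_mul_dualTransfer_self {A : σ → Matrix n n ℂ} {ρ : Matrix n n ℂ}
    (hρ : ∑ s, A s * ρ * (A s)ᴴ = ρ) (X : Matrix n n ℂ) :
    (ρ * dualTransfer A A X).trace = (ρ * X).trace := by
  conv_rhs => rw [← hρ]
  simp only [dualTransfer_apply, Finset.mul_sum, Finset.sum_mul, trace_sum]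
  refine Finset.sum_congr rfl fun s _ => ?_
  rw [Matrix.mul_assoc (A s * ρ), Matrix.mul_assoc (A s), trace_mul_comm (A s)]
  simp only [Matrix.mul_assoc]

variable [DecidableEq m] {A : σ → Matrix m m ℂ} {B : σ → Matrix n n ℂ}

theorem sum_conjTranspose_mul_self_defect (hA : ∑ s, (A s)ᴴ * A s = 1) {Y Z : Matrix m n ℂ}
    (hZ : dualTransfer A B Y = Z) :
    ∑ s, (Y * B s - A s * Z)ᴴ * (Y * B s - A s * Z) = dualTransfer B B (Yᴴ * Y) - Zᴴ * Z := by
  have hcross : ∑ s, Zᴴ * ((A s)ᴴ * Y * B s) = Zᴴ * Z := by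
    rw [← Matrix.mul_sum, ← dualTransfer_apply, hZ]
  have hcross' : ∑ s, (B s)ᴴ * Yᴴ * A s * Z = Zᴴ * Z := by
    rw [← Matrix.sum_mul, ← hZ, dualTransfer_apply, conjTranspose_sum]
    simp only [conjTranspose_mul, conjTranspose_conjTranspose, Matrix.mul_assoc]
  have hlast : ∑ s, Zᴴ * ((A s)ᴴ * A s) * Z = Zᴴ * Z := by
    rw [← Matrix.sum_mul, ← Matrix.mul_sum, hA, Matrix.mul_one]
  have hexpand : ∀ s, (Y * B s - A s * Z)ᴴ * (Y * B s - A s * Z)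
      = (B s)ᴴ * (Yᴴ * Y) * B s - (B s)ᴴ * Yᴴ * A s * Z - Zᴴ * ((A s)ᴴ * Y * B s)
        + Zᴴ * ((A s)ᴴ * A s) * Z := fun s => by
    simp only [conjTranspose_sub, conjTranspose_mul, Matrix.sub_mul, Matrix.mul_sub,
      Matrix.mul_assoc]
    abel
  simp only [hexpand, Finset.sum_add_distrib, Finset.sum_sub_distrib, hcross, hcross', hlast,
    ← dualTransfer_apply]
  abel

end WeightedNorm

section Intertwining

variable {σ m n : Type*} [Fintype σ] [Fintype m] [Fintype n] [DecidableEq m]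
  {A : σ → Matrix m m ℂ}

theorem weightedNormSq_sub_eq_sum_defect {B : σ → Matrix n n ℂ} {ρ : Matrix n n ℂ}
    (hA : ∑ s, (A s)ᴴ * A s = 1) (hB : ∀ X, (ρ * dualTransfer B B X).trace = (ρ * X).trace)
    {Y Z : Matrix m n ℂ} (hZ : dualTransfer A B Y = Z) :
    weightedNormSq ρ Y - weightedNormSq ρ Z = ∑ s, weightedNormSq ρ (Y * B s - A s * Z) := by
  simp only [weightedNormSq]
  rw [← Complex.re_sum, ← trace_sum, ← Matrix.mul_sum, sum_conjTranspose_mul_self_defect hA hZ,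
    Matrix.mul_sub, trace_sub, hB, Complex.sub_re]

theorem conjTranspose_mul_self_of_intertwines {B : σ → Matrix n n ℂ}
    (hA : ∑ s, (A s)ᴴ * A s = 1) {Y Z : Matrix m n ℂ} (hZ : dualTransfer A B Y = Z)
    (hYZ : ∀ s, Y * B s = A s * Z) : Zᴴ * Z = dualTransfer B B (Yᴴ * Y) := by
  have hdefect := sum_conjTranspose_mul_self_defect hA hZ
  simp only [hYZ, sub_self, Matrix.mul_zero, Finset.sum_const_zero] at hdefect
  exact (sub_eq_zero.1 hdefect.symm).symm

variable {B : ℕ → σ → Matrix n n ℂ}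

/-- The weighted norm cannot grow along the transport and does not shrink over a period, so all the
defects vanish. -/
theorem transport_intertwines {ρ : Matrix n n ℂ} (hA : ∑ s, (A s)ᴴ * A s = 1) (hρ : ρ.PosDef)
    (hB : ∀ j X, (ρ * dualTransfer (B j) (B j) X).trace = (ρ * X).trace) {L : ℕ}
    {Y : Matrix m n ℂ} {μ : ℂ} (hμ : 1 ≤ ‖μ‖) (hY : Y ≠ 0) (hL : transport A B L Y = μ • Y) :
    ‖μ‖ = 1 ∧ ∀ j < L, ∀ s, transport A B j Y * B j s = A s * transport A B (j + 1) Y := by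
  obtain ⟨w, hw⟩ : ∃ w : ℕ → ℝ, ∀ j, w j = weightedNormSq ρ (transport A B j Y) :=
    ⟨_, fun _ => rfl⟩
  have hstep : ∀ j, w j - w (j + 1) = ∑ s, weightedNormSq ρ
      (transport A B j Y * B j s - A s * transport A B (j + 1) Y) :=
    fun j => by
      rw [hw, hw]
      exact weightedNormSq_sub_eq_sum_defect hA (hB j) rfl
  have hnonneg : ∀ Z : Matrix m n ℂ, 0 ≤ weightedNormSq ρ Z := weightedNormSq_nonneg hρ.posSemidef
  have hanti : Antitone w := antitone_nat_of_succ_le fun j => by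
    rw [← sub_nonneg, hstep]
    exact Finset.sum_nonneg fun s _ => hnonneg _
  have hwL : w L = ‖μ‖ ^ 2 * w 0 := by rw [hw, hL, weightedNormSq_smul, hw, transport_zero]
  have hw0 : 0 < w 0 := by
    rw [hw, transport_zero]
    exact (hnonneg Y).lt_of_ne' fun h => hY (eq_zero_of_weightedNormSq_eq_zero hρ h)
  have hμ1 : ‖μ‖ = 1 := by
    have hle : ‖μ‖ ^ 2 * w 0 ≤ 1 * w 0 := by
      rw [← hwL, one_mul]
      exact hanti L.zero_le
    exact ((sq_le_one_iff₀ (norm_nonneg μ)).1 (le_of_mul_le_mul_right hle hw0)).antisymm hμ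
  refine ⟨hμ1, fun j hj s => ?_⟩
  have hconst : w j - w (j + 1) ≤ 0 := by
    rw [hμ1, one_pow, one_mul] at hwL
    linarith [hanti j.zero_le, hanti hj]
  have hdefect := (Finset.sum_eq_zero_iff_of_nonneg fun s _ => hnonneg _).1
    ((hstep j).symm.trans (hconst.antisymm (sub_nonneg.2 (hanti j.le_succ)))) s (Finset.mem_univ s)
  exact sub_eq_zero.1 (eq_zero_of_weightedNormSq_eq_zero hρ hdefect)

theorem conjTranspose_mul_self_transport (hA : ∑ s, (A s)ᴴ * A s = 1)
    {E : Module.End ℂ (Matrix n n ℂ)}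
    (hB : ∀ j, dualTransfer (B j) (B j) = E) {L : ℕ} {Y : Matrix m n ℂ}
    (hint : ∀ j < L, ∀ s, transport A B j Y * B j s = A s * transport A B (j + 1) Y) {j : ℕ}
    (hj : j ≤ L) :
    (transport A B j Y)ᴴ * transport A B j Y = (E ^ j) (Yᴴ * Y) := by
  induction j with
  | zero => rfl
  | succ j ih =>
    refine (conjTranspose_mul_self_of_intertwines hA rfl (hint j hj)).trans ?_
    rw [hB, ih (Nat.le_of_succ_le hj), pow_succ', Module.End.mul_apply]

theorem exists_smul_mem_unitaryGroup [Nonempty m] {Y : Matrix m m ℂ} (hY : Y ≠ 0) {z : ℂ}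
    (hz : Yᴴ * Y = z • 1) : ∃ c : ℂ, c • Y ∈ unitaryGroup m ℂ := by
  obtain ⟨i⟩ := ‹Nonempty m›
  have hz0 : 0 ≤ z := by
    simpa [hz] using (posSemidef_conjTranspose_mul_self Y).diag_nonneg (i := i)
  obtain ⟨r, rfl⟩ : ∃ r : ℝ, (r : ℂ) = z := ⟨z.re, Complex.ext rfl (Complex.le_def.1 hz0).2⟩
  have hr : 0 < r := by
    refine (Complex.zero_le_real.1 hz0).lt_of_ne' ?_
    rintro rfl
    exact hY (conjTranspose_mul_self_eq_zero.1 (by simpa using hz))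
  refine ⟨((√r)⁻¹ : ℝ), mem_unitaryGroup_iff'.2 ?_⟩
  rw [star_smul, smul_mul_smul_comm, star_eq_conjTranspose, hz, smul_smul, Complex.star_def,
    Complex.conj_ofReal, ← Complex.ofReal_mul, ← Complex.ofReal_mul, ← mul_inv,
    Real.mul_self_sqrt hr.le, inv_mul_cancel₀ hr.ne', Complex.ofReal_one, one_smul]

end Intertwining

section RingGauges

variable {σ m : Type*} [Fintype m] [DecidableEq m] {A : σ → Matrix m m ℂ} {L : ℕ} [NeZero L]

/-- The tensors `Bᵢ` on a ring of `L` sites are gauge equivalent to `A`, up to phases, by the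
unitaries `v`. As in `IsBondUnitaries`, site `i` lies between the bonds `i` and `i + 1`. -/
def IsRingGauge (A : σ → Matrix m m ℂ) (B : Fin L → σ → Matrix m m ℂ)
    (v : Fin L → unitaryGroup m ℂ) : Prop :=
  ∀ i, ∃ θ : Circle, ∀ s, B i s = (θ : ℂ) • ((v i : Matrix m m ℂ)ᴴ * A s * v (i + 1))

theorem exists_isRingGauge_of_intertwines {B : ℕ → σ → Matrix m m ℂ}
    {T : ℕ → Matrix m m ℂ} (hT : ∀ j ≤ L, T j ∈ unitaryGroup m ℂ) {μ : ℂ} (hμ : ‖μ‖ = 1)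
    (hL : T L = μ • T 0) (hint : ∀ j < L, ∀ s, T j * B j s = A s * T (j + 1)) :
    ∃ v, IsRingGauge A (fun i : Fin L => B i) v := by
  refine ⟨fun i => ⟨T i, hT i i.2.le⟩, fun i => ?_⟩
  have hsolve : ∀ s, B i s = (T i)ᴴ * A s * T (i + 1) := fun s => by
    rw [Matrix.mul_assoc, ← hint i i.2, ← Matrix.mul_assoc, ← star_eq_conjTranspose,
      mem_unitaryGroup_iff'.1 (hT i i.2.le), Matrix.one_mul]
  rcases (Nat.succ_le_of_lt i.2).lt_or_eq with hi | hi
  · exact ⟨1, fun s => by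
      simp only [hsolve, Fin.val_add_one_of_lt' hi, Circle.coe_one, one_smul]⟩
  · have hsucc : ((i + 1 : Fin L) : ℕ) = 0 := by simp [Fin.val_add, show i.val + 1 = L from hi]
    exact ⟨⟨μ, mem_sphere_zero_iff_norm.2 hμ⟩, fun s => by
      simp only [hsolve, hsucc, show i.val + 1 = L from hi, hL, Matrix.mul_smul]⟩

end RingGauges

section GaugeExistence

variable {d χ : ℕ} {A : Fin d → Matrix (Fin χ) (Fin χ) ℂ}

theorem IsInjectiveMPS.exists_isRingGauge (hA : IsInjectiveMPS A) {L : ℕ} [NeZero L]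
    {B : ℕ → Fin d → Matrix (Fin χ) (Fin χ) ℂ}
    (hB : ∀ j, dualTransfer (B j) (B j) = dualTransfer A A)
    (hstate : ∀ k, 0 < k → ∃ θ : Circle, ∀ s,
      ringState (fun i : Fin (k * L) => B (i % L)) s = θ * mpsState A (k * L) s) :
    ∃ v, IsRingGauge A (fun i : Fin L => B i) v := by
  obtain ⟨ρ, hρ, hfix⟩ := hA.right_fixed
  have := hA.nonempty
  obtain ⟨μ, Y, hμ, hY, hL⟩ := hA.exists_transport_eigenvector hstate
  obtain ⟨hμ1, hint⟩ := transport_intertwines hA.left_canonical hρ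
    (fun j X => by rw [hB, trace_mul_dualTransfer_self hfix]) hμ hY hL
  have hgram := fun j => conjTranspose_mul_self_transport hA.left_canonical hB hint (j := j)
  have hYfix : (dualTransfer A A ^ L) (Yᴴ * Y) = ((1 : Circle) : ℂ) • (Yᴴ * Y) := by
    rw [← hgram L le_rfl, hL, conjTranspose_smul, smul_mul_smul_comm, Complex.star_def,
      Complex.conj_mul', hμ1]
    simp
  obtain ⟨z, hz⟩ := hA.eq_smul_one_of_dualTransfer_pow hYfix
  obtain ⟨c, hc⟩ := exists_smul_mem_unitaryGroup hY hz
  have hTL : transport A B L (c • Y) = μ • c • Y := by rw [map_smul, hL, smul_comm]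
  have hint' : ∀ j < L, ∀ s,
      transport A B j (c • Y) * B j s = A s * transport A B (j + 1) (c • Y) := fun j hj s => by
    rw [map_smul, map_smul, Matrix.smul_mul, hint j hj, Matrix.mul_smul]
  refine exists_isRingGauge_of_intertwines (fun j hj => mem_unitaryGroup_iff'.2 ?_) hμ1 hTL hint'
  have hone : dualTransfer A A 1 = 1 := by simpa [dualTransfer_apply] using hA.left_canonical
  rw [star_eq_conjTranspose, conjTranspose_mul_self_transport hA.left_canonical hB hint' hj,
    ← star_eq_conjTranspose, mem_unitaryGroup_iff'.1 hc, Module.End.pow_apply,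
    Function.iterate_fixed hone]

end GaugeExistence

section CentralExtensions

theorem circle_zpow_surjective {n : ℤ} (hn : n ≠ 0) :
    Function.Surjective fun z : Circle => z ^ n := by
  intro z
  obtain ⟨t, rfl⟩ := Circle.exp_surjective z
  exact ⟨Circle.exp (t / n), by
    simp only [← Circle.exp_intCast_mul, mul_div_cancel₀ t (Int.cast_ne_zero.2 hn)]⟩

theorem baer_additive_circle : Module.Baer ℤ (Additive Circle) :=
  letI : DivisibleBy (Additive Circle) ℤ :=
    divisibleByOfSMulRightSurj _ _ fun {_} hn => circle_zpow_surjective hn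
  Module.Baer.of_divisible _

theorem exists_monoidHom_circle_comp_eq {M N : Type*} [CommGroup M] [CommGroup N] {f : M →* N}
    (hf : Function.Injective f) (g : M →* Circle) : ∃ h : N →* Circle, h.comp f = g := by
  obtain ⟨h, hh⟩ := baer_additive_circle.extension_property_addMonoidHom
    (MonoidHom.toAdditive f) hf (MonoidHom.toAdditive g)
  exact ⟨MonoidHom.toAdditive.symm h, MonoidHom.ext fun x => DFunLike.congr_fun hh x⟩

variable {G : Type*} [Group G]

theorem Z2.one_left {ω : G → G → Circle} (hω : ω ∈ Z2 G) (g : G) : ω 1 g = ω 1 1 := by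
  have h := hω 1 1 g
  rw [one_mul, one_mul, mul_comm] at h
  exact (mul_left_cancel h).symm

/-- The underlying type of the central extension of `G` by `U(1)` defined by the cocycle `ω`. -/
@[ext] structure CentralExtension (ω : Z2 G) where
  phase : Circle
  elt : G

namespace CentralExtension

variable (ω : Z2 G)

instance : Mul (CentralExtension ω) :=
  ⟨fun x y => ⟨x.phase * y.phase * ω.1 x.elt y.elt, x.elt * y.elt⟩⟩

instance : One (CentralExtension ω) := ⟨⟨(ω.1 1 1)⁻¹, 1⟩⟩

instance : Inv (CentralExtension ω) :=
  ⟨fun x => ⟨x.phase⁻¹ * (ω.1 x.elt⁻¹ x.elt)⁻¹ * (ω.1 1 1)⁻¹, x.elt⁻¹⟩⟩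

variable {ω}

@[simp] theorem phase_mul (x y : CentralExtension ω) :
    (x * y).phase = x.phase * y.phase * ω.1 x.elt y.elt := rfl

@[simp] theorem elt_mul (x y : CentralExtension ω) : (x * y).elt = x.elt * y.elt := rfl

protected theorem mul_assoc (x y z : CentralExtension ω) : x * y * z = x * (y * z) := by
  refine CentralExtension.ext ?_ (mul_assoc x.elt y.elt z.elt)
  simp only [phase_mul, elt_mul]
  calc x.phase * y.phase * ω.1 x.elt y.elt * z.phase * ω.1 (x.elt * y.elt) z.elt
      = x.phase * y.phase * z.phase * (ω.1 x.elt y.elt * ω.1 (x.elt * y.elt) z.elt) := by ac_rfl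
    _ = x.phase * y.phase * z.phase * (ω.1 y.elt z.elt * ω.1 x.elt (y.elt * z.elt)) := by
      rw [ω.2 x.elt y.elt z.elt]
    _ = _ := by ac_rfl

protected theorem one_mul (x : CentralExtension ω) : 1 * x = x := by
  refine CentralExtension.ext ?_ (one_mul x.elt)
  change (ω.1 1 1)⁻¹ * x.phase * ω.1 1 x.elt = x.phase
  rw [Z2.one_left ω.2 x.elt, mul_right_comm, inv_mul_cancel, one_mul]

protected theorem inv_mul_cancel (x : CentralExtension ω) : x⁻¹ * x = 1 := by
  refine CentralExtension.ext ?_ (inv_mul_cancel x.elt)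
  change x.phase⁻¹ * (ω.1 x.elt⁻¹ x.elt)⁻¹ * (ω.1 1 1)⁻¹ * x.phase * ω.1 x.elt⁻¹ x.elt = (ω.1 1 1)⁻¹
  calc _ = (x.phase⁻¹ * x.phase) * ((ω.1 x.elt⁻¹ x.elt)⁻¹ * ω.1 x.elt⁻¹ x.elt) * (ω.1 1 1)⁻¹ := by
        ac_rfl
    _ = (ω.1 1 1)⁻¹ := by rw [inv_mul_cancel, inv_mul_cancel, one_mul, one_mul]

instance : Group (CentralExtension ω) :=
  Group.ofLeftAxioms CentralExtension.mul_assoc CentralExtension.one_mul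
    CentralExtension.inv_mul_cancel

variable (ω) in
/-- The embedding of `U(1)` in the central extension. The identity of the extension lies over
`1 : G` with phase `ω(1,1)⁻¹`, since `ω` need not be normalized. -/
def ofCircle : Circle →* CentralExtension ω :=
  MonoidHom.mk' (fun z => ⟨z * (ω.1 1 1)⁻¹, 1⟩) fun z w => by
    refine CentralExtension.ext ?_ (mul_one 1).symm
    rw [phase_mul, ← mul_assoc, inv_mul_cancel_right, mul_right_comm]

theorem ofCircle_injective : Function.Injective (ofCircle ω) :=
  fun _ _ h => mul_right_cancel (congrArg phase h)

theorem mk_one_mul_mk_one (g h : G) :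
    (⟨1, g⟩ * ⟨1, h⟩ : CentralExtension ω) = ofCircle ω (ω.1 g h) * ⟨1, g * h⟩ := by
  refine CentralExtension.ext ?_ (one_mul (g * h)).symm
  change 1 * 1 * ω.1 g h = ω.1 g h * (ω.1 1 1)⁻¹ * 1 * ω.1 1 (g * h)
  rw [Z2.one_left ω.2 (g * h), one_mul, one_mul, mul_one, inv_mul_cancel_right]

theorem mem_B2_of_retraction (r : CentralExtension ω →* Circle)
    (hr : r.comp (ofCircle ω) = MonoidHom.id Circle) : ω.1 ∈ B2 G := by
  refine ⟨fun g => r ⟨1, g⟩, fun g h => ?_⟩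
  rw [← map_mul, mk_one_mul_mk_one, map_mul, show r (ofCircle ω (ω.1 g h)) = ω.1 g h from
    DFunLike.congr_fun hr _, mul_div_cancel_right]

end CentralExtension

theorem mem_B2_of_symm {G : Type*} [CommGroup G] {ω : Z2 G} (hsymm : ∀ g h, ω.1 g h = ω.1 h g) :
    ω.1 ∈ B2 G := by
  let : CommGroup (CentralExtension ω) :=
    { (inferInstance : Group (CentralExtension ω)) with
      mul_comm := fun x y => CentralExtension.ext
        (by rw [CentralExtension.phase_mul, CentralExtension.phase_mul, hsymm, mul_comm x.phase])
        (mul_comm x.elt y.elt) }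
  obtain ⟨r, hr⟩ := exists_monoidHom_circle_comp_eq (f := CentralExtension.ofCircle ω)
    CentralExtension.ofCircle_injective (MonoidHom.id Circle)
  exact CentralExtension.mem_B2_of_retraction r hr

end CentralExtensions

section CommutatorPairing

theorem H2.mk_eq_mk_iff {G : Type*} [Group G] {ω η : Z2 G} :
    H2.mk ω = H2.mk η ↔ (η / ω).1 ∈ B2 G := by
  rw [H2.mk, H2.mk, QuotientGroup.eq, Subgroup.mem_subgroupOf, div_eq_inv_mul]

/-- The pull-back of a cocycle along a homomorphism. -/
def Z2.pullback {G H : Type*} [Group G] [Group H] (f : G →* H) : Z2 H →* Z2 G :=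
  MonoidHom.mk' (fun ω => ⟨fun g h => ω.1 (f g) (f h), fun g h k => by
    simpa only [map_mul] using ω.2 (f g) (f h) (f k)⟩) fun _ _ => rfl

variable {G : Type*} [CommGroup G]

theorem Z2.mul_left_div_swap {ω : G → G → Circle} (hω : ω ∈ Z2 G) (g h k : G) :
    ω (g * h) k / ω k (g * h) = (ω g k / ω k g) * (ω h k / ω k h) := by
  rw [div_mul_div_comm, div_eq_div_iff_mul_eq_mul]
  refine mul_left_cancel (a := ω g h * ω (g * k) h) ?_
  have hghk := hω g h k
  have hkgh := hω k g h
  have hgkh := hω g k h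
  rw [mul_comm k g] at hkgh
  rw [mul_comm k h] at hgkh
  calc ω g h * ω (g * k) h * (ω (g * h) k * (ω k g * ω k h))
      = (ω g h * ω (g * h) k) * (ω k g * ω (g * k) h) * ω k h := by ac_rfl
    _ = (ω k h * ω g (h * k)) * (ω g h * ω h k * ω k (g * h)) := by rw [hghk, hkgh]; ac_rfl
    _ = (ω g k * ω (g * k) h) * (ω g h * ω h k * ω k (g * h)) := by rw [hgkh]
    _ = _ := by ac_rfl

/-- The commutator pairing `ω(g,h) ω(h,g)⁻¹` of a 2-cocycle on an abelian group: the commutator of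
lifts of `g` and `h` to the central extension. -/
def commutatorPairing : Z2 G →* G →* G →* Circle :=
  MonoidHom.mk'
    (fun ω => MonoidHom.mk'
      (fun g => MonoidHom.mk' (fun h => ω.1 g h / ω.1 h g) fun h k => by
        rw [← inv_div, Z2.mul_left_div_swap ω.2, mul_inv, inv_div, inv_div])
      fun g h => MonoidHom.ext fun k => Z2.mul_left_div_swap ω.2 g h k)
    fun ω η => by
      ext g h : 2
      exact mul_div_mul_comm _ _ _ _

theorem commutatorPairing_apply (ω : Z2 G) (g h : G) :
    commutatorPairing ω g h = ω.1 g h / ω.1 h g := rfl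

theorem commutatorPairing_swap (ω : Z2 G) (g h : G) :
    commutatorPairing ω h g = (commutatorPairing ω g h)⁻¹ := (inv_div _ _).symm

theorem commutatorPairing_pullback {H : Type*} [CommGroup H] (f : G →* H) (ω : Z2 H) (g h : G) :
    commutatorPairing (Z2.pullback f ω) g h = commutatorPairing ω (f g) (f h) := rfl

theorem mem_B2_iff_commutatorPairing_eq_one {ω : Z2 G} :
    ω.1 ∈ B2 G ↔ commutatorPairing ω = 1 := by
  refine ⟨?_, fun h => mem_B2_of_symm fun g k => ?_⟩
  · rintro ⟨β, hβ⟩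
    ext g h : 2
    rw [commutatorPairing_apply, hβ, hβ, mul_comm (β h), mul_comm h, div_self']
    rfl
  · exact div_eq_one.1 (DFunLike.congr_fun (DFunLike.congr_fun h g) k)

theorem zpow_mem_B2_iff {ω : Z2 G} {n : ℤ} :
    ω.1 ^ n ∈ B2 G ↔ ∀ g h, commutatorPairing ω g h ^ n = 1 := by
  rw [← Subgroup.coe_zpow, mem_B2_iff_commutatorPairing_eq_one, map_zpow]
  simp only [DFunLike.ext_iff, MonoidHom.zpow_apply, MonoidHom.one_apply]

theorem H2.mk_eq_mk_iff_commutatorPairing {ω η : Z2 G} :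
    H2.mk ω = H2.mk η ↔ commutatorPairing ω = commutatorPairing η := by
  rw [H2.mk_eq_mk_iff, mem_B2_iff_commutatorPairing_eq_one, map_div, div_eq_one, eq_comm]

theorem commutatorPairing_zpow_mul_sub_one {ω : Z2 G} {g h : G} {m n : ℤ}
    (hinv : commutatorPairing ω (g ^ m) (h ^ n) = commutatorPairing ω g h) :
    commutatorPairing ω g h ^ (m * n - 1) = 1 := by
  rw [map_zpow, map_zpow, MonoidHom.zpow_apply, ← _root_.zpow_mul] at hinv
  rw [_root_.zpow_sub_one, hinv, mul_inv_cancel]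

end CommutatorPairing

section Sectors

variable {Ga Gb : Type*} [CommGroup Ga] [CommGroup Gb]

theorem sectorA_eq_pullback (ω : Z2 (Ga × Gb)) :
    sectorA ω.1 = (Z2.pullback (MonoidHom.inl Ga Gb) ω).1 := rfl

theorem sectorB_eq_pullback (ω : Z2 (Ga × Gb)) :
    sectorB ω.1 = (Z2.pullback (MonoidHom.inr Ga Gb) ω).1 := rfl

theorem mixedPhase_eq_commutatorPairing (ω : Z2 (Ga × Gb)) (ga : Ga) (gb : Gb) :
    mixedPhase ω.1 ga gb = commutatorPairing ω (ga, 1) (1, gb) := rfl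

theorem mixedPhase_zpow_zpow (ω : Z2 (Ga × Gb)) (m n : ℤ) (ga : Ga) (gb : Gb) :
    mixedPhase ω.1 (ga ^ m) (gb ^ n) = mixedPhase ω.1 ga gb ^ (m * n) := by
  have hpow : commutatorPairing ω ((ga, 1) ^ m) ((1, gb) ^ n)
      = commutatorPairing ω (ga, 1) (1, gb) ^ (m * n) := by
    rw [map_zpow, map_zpow, MonoidHom.zpow_apply, _root_.zpow_mul]
  rwa [Prod.pow_mk, Prod.pow_mk, _root_.one_zpow, _root_.one_zpow] at hpow

/-- The mixed sector as an element of the group of cocycles. -/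
def Z2.mixed (ω : Z2 (Ga × Gb)) : Z2 (Ga × Gb) :=
  ω / (pullback ((MonoidHom.inl Ga Gb).comp (MonoidHom.fst Ga Gb)) ω *
    pullback ((MonoidHom.inr Ga Gb).comp (MonoidHom.snd Ga Gb)) ω)

theorem sectorMixed_eq_mixed (ω : Z2 (Ga × Gb)) : sectorMixed ω.1 = (Z2.mixed ω).1 := rfl

theorem commutatorPairing_prod (ω : Z2 (Ga × Gb)) (g h : Ga × Gb) :
    commutatorPairing ω g h
      = mixedPhase ω.1 g.1 h.2 / mixedPhase ω.1 h.1 g.2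
        * (commutatorPairing ω (g.1, 1) (h.1, 1) * commutatorPairing ω (1, g.2) (1, h.2)) := by
  have hsplit : ∀ x : Ga × Gb, x = (x.1, 1) * (1, x.2) := fun x => by simp
  conv_lhs => rw [hsplit g, hsplit h]
  rw [map_mul (commutatorPairing ω), MonoidHom.mul_apply, map_mul, map_mul,
    mixedPhase_eq_commutatorPairing, mixedPhase_eq_commutatorPairing, div_eq_mul_inv,
    ← commutatorPairing_swap, mul_comm (commutatorPairing ω (g.1, 1) (h.1, 1)), mul_mul_mul_comm]

theorem commutatorPairing_mixed (ω : Z2 (Ga × Gb)) (g h : Ga × Gb) :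
    commutatorPairing (G := Ga × Gb) (Z2.mixed ω) g h
      = mixedPhase ω.1 g.1 h.2 / mixedPhase ω.1 h.1 g.2 := by
  rw [Z2.mixed, map_div, map_mul, MonoidHom.div_apply, MonoidHom.div_apply, MonoidHom.mul_apply,
    MonoidHom.mul_apply, commutatorPairing_prod ω g h]
  exact mul_div_cancel_right _ _

/-- The endomorphism `(g_a, g_b) ↦ (g_a ^ a, g_b ^ b)` by which a translation by one site acts on
two exponential symmetries. -/
def modulation (Ga Gb : Type*) [CommGroup Ga] [CommGroup Gb] (a b : ℤ) : Monoid.End (Ga × Gb) :=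
  (zpowGroupHom a).prodMap (zpowGroupHom b)

theorem modulation_apply (a b : ℤ) (g : Ga × Gb) : modulation Ga Gb a b g = (g.1 ^ a, g.2 ^ b) :=
  rfl

variable {a b : ℤ} {ω : Z2 (Ga × Gb)}

theorem commutatorPairing_modulation
    (hω : H2.mk (Z2.pullback (modulation Ga Gb a b) ω) = H2.mk ω) (g h : Ga × Gb) :
    commutatorPairing ω (g.1 ^ a, g.2 ^ b) (h.1 ^ a, h.2 ^ b) = commutatorPairing ω g h :=
  DFunLike.congr_fun (DFunLike.congr_fun (H2.mk_eq_mk_iff_commutatorPairing.1 hω) g) h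

theorem sectorA_zpow_mem_B2 (hω : H2.mk (Z2.pullback (modulation Ga Gb a b) ω) = H2.mk ω) :
    sectorA ω.1 ^ (a ^ 2 - 1) ∈ B2 Ga := by
  rw [sectorA_eq_pullback, zpow_mem_B2_iff, sq]
  intro g h
  rw [commutatorPairing_pullback]
  exact commutatorPairing_zpow_mul_sub_one
    (by simpa using commutatorPairing_modulation hω (g, 1) (h, 1))

theorem sectorB_zpow_mem_B2 (hω : H2.mk (Z2.pullback (modulation Ga Gb a b) ω) = H2.mk ω) :
    sectorB ω.1 ^ (b ^ 2 - 1) ∈ B2 Gb := by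
  rw [sectorB_eq_pullback, zpow_mem_B2_iff, sq]
  intro g h
  rw [commutatorPairing_pullback]
  exact commutatorPairing_zpow_mul_sub_one
    (by simpa using commutatorPairing_modulation hω (1, g) (1, h))

theorem mixedPhase_zpow_eq_one (hω : H2.mk (Z2.pullback (modulation Ga Gb a b) ω) = H2.mk ω)
    (ga : Ga) (gb : Gb) : mixedPhase ω.1 ga gb ^ (a * b - 1) = 1 := by
  rw [mixedPhase_eq_commutatorPairing]
  exact commutatorPairing_zpow_mul_sub_one
    (by simpa using commutatorPairing_modulation hω (ga, 1) (1, gb))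

theorem sectorMixed_zpow_mem_B2 (hω : H2.mk (Z2.pullback (modulation Ga Gb a b) ω) = H2.mk ω) :
    sectorMixed ω.1 ^ (a * b - 1) ∈ B2 (Ga × Gb) := by
  rw [sectorMixed_eq_mixed, zpow_mem_B2_iff]
  intro g h
  rw [commutatorPairing_mixed, div_zpow, mixedPhase_zpow_eq_one hω, mixedPhase_zpow_eq_one hω,
    div_one]

end Sectors

section GaugeUniqueness

variable {σ m : Type*} [Fintype m] [DecidableEq m]

theorem exists_circle_eq_of_smul_one_mem_unitaryGroup [Nonempty m] {z : ℂ}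
    (hz : z • (1 : Matrix m m ℂ) ∈ unitaryGroup m ℂ) :
    ∃ θ : Circle, (θ : ℂ) = z := by
  obtain ⟨j⟩ := ‹Nonempty m›
  have hdiag := congrFun (congrFun (mem_unitaryGroup_iff'.1 hz) j) j
  rw [star_smul, star_one, smul_mul_smul_comm, one_mul, Matrix.smul_apply, Matrix.one_apply_eq,
    smul_eq_mul, mul_one, Complex.star_def, Complex.conj_mul'] at hdiag
  have hnorm : ‖z‖ ^ 2 = 1 := by exact_mod_cast hdiag
  exact ⟨⟨z, mem_sphere_zero_iff_norm.2
    ((pow_eq_one_iff_of_nonneg (norm_nonneg z) two_ne_zero).1 hnorm)⟩, rfl⟩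

variable {A : σ → Matrix m m ℂ} {L : ℕ} [NeZero L]

theorem IsRingGauge.mul_star {B : Fin L → σ → Matrix m m ℂ}
    {v w : Fin L → unitaryGroup m ℂ} (hv : IsRingGauge A B v)
    (hw : IsRingGauge A B w) : IsRingGauge A (fun _ => A) (w * star v) := by
  intro i
  obtain ⟨θ, hθ⟩ := hv i
  obtain ⟨η, hη⟩ := hw i
  have hvi : (v i : Matrix m m ℂ) * (v i : Matrix m m ℂ)ᴴ = 1 := Unitary.coe_mul_star_self _
  have hvi' : (v (i + 1) : Matrix m m ℂ) * (v (i + 1) : Matrix m m ℂ)ᴴ = 1 :=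
    Unitary.coe_mul_star_self _
  refine ⟨θ⁻¹ * η, fun s => ?_⟩
  calc A s = (θ : ℂ)⁻¹ • (v i * ((θ : ℂ) • ((v i : Matrix m m ℂ)ᴴ * A s * v (i + 1)))
        * (v (i + 1) : Matrix m m ℂ)ᴴ) := by
        rw [Matrix.mul_smul, Matrix.smul_mul, inv_smul_smul₀ (Circle.coe_ne_zero θ),
          ← Matrix.mul_assoc, ← Matrix.mul_assoc, hvi, Matrix.one_mul, Matrix.mul_assoc, hvi',
          Matrix.mul_one]
    _ = _ := by
        rw [← hθ, hη, Matrix.mul_smul, Matrix.smul_mul, smul_smul, Circle.coe_mul, Circle.coe_inv]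
        simp [star_eq_conjTranspose, Matrix.mul_assoc]

theorem dualTransfer_of_isRingGauge_self [Fintype σ]
    (hA : ∑ s, (A s)ᴴ * A s = 1) {u : Fin L → unitaryGroup m ℂ}
    (hu : IsRingGauge A (fun _ => A) u) (i : Fin L) :
    ∃ θ : Circle, dualTransfer A A (u i).1 = (θ : ℂ) • (u (i + 1)).1 := by
  obtain ⟨θ, hθ⟩ := hu i
  have hui : (u i : Matrix m m ℂ) * (u i : Matrix m m ℂ)ᴴ = 1 := Unitary.coe_mul_star_self _
  have hcomm : ∀ s, (u i).1 * A s = (θ : ℂ) • (A s * (u (i + 1)).1) := fun s => by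
    conv_lhs => rw [show A s = _ from hθ s, Matrix.mul_smul, ← Matrix.mul_assoc,
      ← Matrix.mul_assoc, hui, Matrix.one_mul]
  refine ⟨θ, ?_⟩
  simp only [dualTransfer_apply, Matrix.mul_assoc, hcomm, Matrix.mul_smul]
  rw [← Finset.smul_sum]
  simp only [← Matrix.mul_assoc]
  rw [← Matrix.sum_mul, hA, Matrix.one_mul]

theorem exists_dualTransfer_pow_of_isRingGauge_self [Fintype σ] (hA : ∑ s, (A s)ᴴ * A s = 1)
    {u : Fin L → unitaryGroup m ℂ} (hu : IsRingGauge A (fun _ => A) u) (i : Fin L) (k : ℕ) :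
    ∃ θ : Circle, (dualTransfer A A ^ k) (u i).1 = (θ : ℂ) • (u (i + k • (1 : Fin L))).1 := by
  induction k with
  | zero => exact ⟨1, by simp⟩
  | succ k ih =>
    obtain ⟨θ, hθ⟩ := ih
    obtain ⟨η, hη⟩ := dualTransfer_of_isRingGauge_self hA hu (i + k • (1 : Fin L))
    exact ⟨θ * η, by
      rw [pow_succ', Module.End.mul_apply, hθ, map_smul, hη, smul_smul, Circle.coe_mul, succ_nsmul,
        add_assoc]⟩

end GaugeUniqueness

section InjectiveGaugeUniqueness

variable {d χ : ℕ} {A : Fin d → Matrix (Fin χ) (Fin χ) ℂ} {L : ℕ} [NeZero L]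

theorem IsInjectiveMPS.eq_smul_one_of_isRingGauge_self (hA : IsInjectiveMPS A)
    {u : Fin L → unitaryGroup (Fin χ) ℂ} (hu : IsRingGauge A (fun _ => A) u) (i : Fin L) :
    ∃ φ : Circle, (u i).1 = (φ : ℂ) • 1 := by
  have := hA.nonempty
  obtain ⟨θ, hθ⟩ := exists_dualTransfer_pow_of_isRingGauge_self hA.left_canonical hu i L
  have hperiod : i + L • (1 : Fin L) = i := by
    simpa only [Fintype.card_fin, add_zero] using
      congrArg (i + ·) (card_nsmul_eq_zero (x := (1 : Fin L)))
  rw [hperiod] at hθ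
  obtain ⟨z, hz⟩ := hA.eq_smul_one_of_dualTransfer_pow hθ
  obtain ⟨φ, rfl⟩ := exists_circle_eq_of_smul_one_mem_unitaryGroup (hz ▸ (u i).2)
  exact ⟨φ, hz⟩

theorem IsInjectiveMPS.eq_smul_of_isRingGauge (hA : IsInjectiveMPS A)
    {B : Fin L → Fin d → Matrix (Fin χ) (Fin χ) ℂ} {v w : Fin L → unitaryGroup (Fin χ) ℂ}
    (hv : IsRingGauge A B v) (hw : IsRingGauge A B w) (i : Fin L) :
    ∃ φ : Circle, (w i).1 = (φ : ℂ) • (v i).1 := by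
  obtain ⟨φ, hφ⟩ := hA.eq_smul_one_of_isRingGauge_self (hv.mul_star hw) i
  refine ⟨φ, ?_⟩
  calc (w i).1 = ((w * star v) i * v i : unitaryGroup (Fin χ) ℂ).1 := by simp [mul_assoc]
    _ = (φ : ℂ) • (v i).1 := by
      rw [Submonoid.coe_mul, hφ, Matrix.smul_mul, Matrix.one_mul]

end InjectiveGaugeUniqueness

section FactorSystems

variable {G H : Type*} [Group G] [Group H] {χ : ℕ}

theorem circle_smul_unitary_injective {m : Type*} [Fintype m] [DecidableEq m] [Nonempty m]
    (v : unitaryGroup m ℂ) : Function.Injective fun z : Circle => (z : ℂ) • v.1 := by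
  have hv : v.1 ≠ 0 := fun hzero => zero_ne_one <| by
    simpa only [hzero, zero_mul] using Unitary.coe_mul_star_self v
  exact (smul_left_injective ℂ hv).comp Circle.coe_injective

theorem IsFactorSystem.mem_Z2 [Nonempty (Fin χ)] {v : G → unitaryGroup (Fin χ) ℂ}
    {ω : G → G → Circle} (h : IsFactorSystem v ω) : ω ∈ Z2 G := by
  intro g k l
  have hleft : (v g).1 * (v k).1 * (v l).1
      = ((ω g k * ω (g * k) l : Circle) : ℂ) • (v (g * k * l)).1 := by
    rw [h g k, Matrix.smul_mul, h (g * k) l, smul_smul, Circle.coe_mul]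
  have hright : (v g).1 * ((v k).1 * (v l).1)
      = ((ω k l * ω g (k * l) : Circle) : ℂ) • (v (g * (k * l))).1 := by
    rw [h k l, Matrix.mul_smul, h g (k * l), smul_smul, Circle.coe_mul]
  refine circle_smul_unitary_injective (v (g * k * l)) ?_
  beta_reduce
  rw [← hleft, mul_assoc g k l, ← hright, Matrix.mul_assoc]

theorem IsFactorSystem.comp {v : G → unitaryGroup (Fin χ) ℂ} {ω : Z2 G}
    (h : IsFactorSystem v ω.1) (f : H →* G) : IsFactorSystem (v ∘ f) (Z2.pullback f ω).1 :=
  fun g k => by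
    change _ = (ω.1 (f g) (f k) : ℂ) • (v (f (g * k))).1
    rw [map_mul]
    exact h (f g) (f k)

theorem IsFactorSystem.mk_eq_of_smul [Nonempty (Fin χ)] {v w : G → unitaryGroup (Fin χ) ℂ}
    {ω η : Z2 G} (hω : IsFactorSystem v ω.1) (hη : IsFactorSystem w η.1)
    (h : ∀ g, ∃ φ : Circle, (w g).1 = (φ : ℂ) • (v g).1) : H2.mk ω = H2.mk η := by
  choose β hβ using h
  refine H2.mk_eq_mk_iff.2 ⟨β, fun g k => ?_⟩
  change η.1 g k / ω.1 g k = _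
  rw [div_eq_div_iff_mul_eq_mul]
  refine circle_smul_unitary_injective (v (g * k)) ?_
  have hmul := hη g k
  rw [hβ, hβ, hβ, smul_mul_smul_comm, hω g k, smul_smul, smul_smul] at hmul
  simpa only [Circle.coe_mul] using hmul.symm

end FactorSystems

section SiteGauges

variable {σ m : Type*} [Fintype σ] [Fintype m] {A : σ → Matrix m m ℂ}

theorem siteAct_mul_of_gauge {W₁ W₂ : Matrix σ σ ℂ} {θ₁ θ₂ : Circle} {v₁ v₂ w₁ w₂ : Matrix m m ℂ}
    (h₁ : ∀ s, siteAct W₁ A s = (θ₁ : ℂ) • (v₁ᴴ * A s * w₁))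
    (h₂ : ∀ s, siteAct W₂ A s = (θ₂ : ℂ) • (v₂ᴴ * A s * w₂)) (s : σ) :
    siteAct (W₁ * W₂) A s
      = ((θ₁ * θ₂ : Circle) : ℂ) • ((v₁ * v₂)ᴴ * A s * (w₁ * w₂)) := by
  rw [← siteAct_siteAct, funext h₂, siteAct_smul, siteAct_mul_mul, h₁, Matrix.mul_smul,
    Matrix.smul_mul, smul_smul, mul_comm (θ₂ : ℂ), Circle.coe_mul, conjTranspose_mul]
  simp only [Matrix.mul_assoc]

theorem conjTranspose_mul_mul_ne_zero [DecidableEq m] {X : Matrix m m ℂ} (hX : X ≠ 0)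
    (v w : unitaryGroup m ℂ) : (v : Matrix m m ℂ)ᴴ * X * (w : Matrix m m ℂ) ≠ 0 := by
  have hv : (v : Matrix m m ℂ) * (v : Matrix m m ℂ)ᴴ = 1 := Unitary.coe_mul_star_self v
  have hw : (w : Matrix m m ℂ) * (w : Matrix m m ℂ)ᴴ = 1 := Unitary.coe_mul_star_self w
  refine fun hzero => hX ?_
  calc X = v * ((v : Matrix m m ℂ)ᴴ * X * w) * (w : Matrix m m ℂ)ᴴ := by
        rw [Matrix.mul_assoc _ X, ← Matrix.mul_assoc, hv, Matrix.one_mul, Matrix.mul_assoc, hw,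
          Matrix.mul_one]
    _ = 0 := by rw [hzero, Matrix.mul_zero, Matrix.zero_mul]

end SiteGauges

section BondClasses

variable {d χ : ℕ} {A : Fin d → Matrix (Fin χ) (Fin χ) ℂ}

-- A linear on-site action allows no net projective phase on a site, so the two factor systems
-- differ by the coboundary of the gauge phases.
theorem mk_eq_mk_of_siteAct {G : Type*} [Group G] (hA : ∃ s, A s ≠ 0)
    {W : G →* unitaryGroup (Fin d) ℂ}
    {v w : G → unitaryGroup (Fin χ) ℂ}
    (h : ∀ g, ∃ θ : Circle, ∀ s, siteAct (W g).1 A s = (θ : ℂ) • ((v g).1ᴴ * A s * (w g).1))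
    {ω η : Z2 G} (hω : IsFactorSystem v ω.1) (hη : IsFactorSystem w η.1) :
    H2.mk ω = H2.mk η := by
  choose θ hθ using h
  obtain ⟨s, hs⟩ := hA
  have hphase : ∀ g k, θ (g * k) = θ g * θ k * (η.1 g k / ω.1 g k) := fun g k => by
    have hmul := siteAct_mul_of_gauge (hθ g) (hθ k) s
    rw [← Submonoid.coe_mul, ← map_mul, hθ, hω g k, hη g k, conjTranspose_smul, Matrix.smul_mul,
      Matrix.mul_smul, Matrix.smul_mul, smul_smul, smul_smul] at hmul
    refine Circle.ext ?_
    rw [smul_left_injective ℂ (conjTranspose_mul_mul_ne_zero hs _ _) hmul, Complex.star_def,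
      ← Circle.coe_inv_eq_conj]
    simp only [Circle.coe_mul, Circle.coe_div, Circle.coe_inv]
    ring
  refine H2.mk_eq_mk_iff.2 ⟨fun g => (θ g)⁻¹, fun g k => ?_⟩
  change η.1 g k / ω.1 g k = (θ g)⁻¹ * (θ k)⁻¹ / (θ (g * k))⁻¹
  rw [hphase, div_inv_eq_mul, ← mul_inv, inv_mul_cancel_left]

variable {L : ℕ} [NeZero L]

theorem isBondUnitaries_iff {G : Type*} {W : Fin L → G → unitaryGroup (Fin d) ℂ}
    {v : Fin L → G → unitaryGroup (Fin χ) ℂ} :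
    IsBondUnitaries A W v ↔
      ∀ g, IsRingGauge A (fun i => siteAct (W i g).1 A) fun i => v i g :=
  forall_comm

open Fin.NatCast in
theorem apply_eq_apply_zero_of_succ {α : Type*} {f : Fin L → α} (hf : ∀ i, f i = f (i + 1))
    (i : Fin L) : f i = f 0 := by
  have hcast : ∀ n : ℕ, f (n : Fin L) = f 0 := fun n => by
    induction n with
    | zero => rw [Fin.natCast_zero]
    | succ n ih => rw [← ih, hf n, Nat.cast_succ]
  simpa only [Fin.cast_val_eq_self] using hcast i

variable {G : Type*} [Group G] {W : Fin L → G →* unitaryGroup (Fin d) ℂ}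
  {v w : Fin L → G → unitaryGroup (Fin χ) ℂ}

theorem IsBondUnitaries.exists_factorSystem (hA : IsInjectiveMPS A)
    (hv : IsBondUnitaries A (fun i => W i) v) (i : Fin L) :
    ∃ ω : Z2 G, IsFactorSystem (v i) ω.1 := by
  have := hA.nonempty
  have hproj : ∀ g h, ∃ φ : Circle, (v i g).1 * (v i h).1 = (φ : ℂ) • (v i (g * h)).1 := by
    refine fun g h => hA.eq_smul_of_isRingGauge (isBondUnitaries_iff.1 hv (g * h))
      (w := fun i => v i g * v i h) (fun j => ?_) i
    obtain ⟨θ, hθ⟩ := hv j g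
    obtain ⟨η, hη⟩ := hv j h
    exact ⟨θ * η, fun s => by
      beta_reduce
      rw [map_mul]
      exact siteAct_mul_of_gauge hθ hη s⟩
  choose ω hω using hproj
  exact ⟨⟨ω, IsFactorSystem.mem_Z2 hω⟩, hω⟩

theorem IsBondUnitaries.mk_eq_mk (hA : IsInjectiveMPS A)
    (hv : IsBondUnitaries A (fun i => W i) v) (hw : IsBondUnitaries A (fun i => W i) w)
    {i j : Fin L} {ω η : Z2 G} (hω : IsFactorSystem (v i) ω.1) (hη : IsFactorSystem (w j) η.1) :
    H2.mk ω = H2.mk η := by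
  have := hA.nonempty
  choose ζ hζ using hv.exists_factorSystem hA
  have hconst := apply_eq_apply_zero_of_succ (f := fun i => H2.mk (ζ i)) fun i =>
    mk_eq_mk_of_siteAct hA.exists_ne_zero (hv i) (hζ i) (hζ (i + 1))
  calc H2.mk ω = H2.mk (ζ i) := hω.mk_eq_of_smul (hζ i) fun g => ⟨1, by simp⟩
    _ = H2.mk (ζ j) := (hconst i).trans (hconst j).symm
    _ = H2.mk η := (hζ j).mk_eq_of_smul hη fun g => hA.eq_smul_of_isRingGauge
      (isBondUnitaries_iff.1 hv g) (isBondUnitaries_iff.1 hw g) j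

end BondClasses

section Translation

variable {G : Type*} [Group G] {d χ L : ℕ} [NeZero L] {A : Fin d → Matrix (Fin χ) (Fin χ) ℂ}
  {U : G →* unitaryGroup (Fin d) ℂ} {τ : Monoid.End G}
  {v : Fin L → G → unitaryGroup (Fin χ) ℂ}

theorem pow_val_add_one {M : Type*} [Monoid M] {x : M} (hx : x ^ L = 1) (i : Fin L) :
    x ^ (i + 1 : Fin L).val = x ^ i.val * x := by
  rw [Fin.val_add, ← pow_eq_pow_mod _ hx, pow_add, Fin.val_one', ← pow_eq_pow_mod _ hx, pow_one]

theorem IsBondUnitaries.translate (hτ : τ ^ L = 1)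
    (hv : IsBondUnitaries A (fun i => U.comp (τ ^ i.val)) v) :
    IsBondUnitaries A (fun i => U.comp (τ ^ i.val)) fun i => v (i - 1) ∘ τ := by
  intro i g
  obtain ⟨j, rfl⟩ : ∃ j, i = j + 1 := ⟨i - 1, (sub_add_cancel i 1).symm⟩
  obtain ⟨θ, hθ⟩ := hv j (τ g)
  refine ⟨θ, fun s => ?_⟩
  simp only [add_sub_cancel_right, pow_val_add_one hτ]
  exact hθ s

theorem IsBondUnitaries.mk_pullback_eq (hA : IsInjectiveMPS A) (hτ : τ ^ L = 1)
    (hv : IsBondUnitaries A (fun i => U.comp (τ ^ i.val)) v) {i : Fin L} {ω : Z2 G}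
    (hω : IsFactorSystem (v i) ω.1) : H2.mk (Z2.pullback τ ω) = H2.mk ω :=
  (hv.translate hτ).mk_eq_mk hA (W := fun i => U.comp (τ ^ i.val)) hv (i := i + 1)
    (by rw [add_sub_cancel_right]; exact hω.comp τ) hω

end Translation

section ExponentialSymmetries

variable {d χ L : ℕ} {A : Fin d → Matrix (Fin χ) (Fin χ) ℂ} {a b : ℤ}

theorem IsSymmetricMPS.exists_isBondUnitaries [NeZero L] {Ga Gb : Type*} [Group Ga] [Group Gb]
    {U : Ga × Gb →* unitaryGroup (Fin d) ℂ} (hA : IsInjectiveMPS A)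
    (hS : IsSymmetricMPS A U a b L) :
    ∃ v : Fin L → Ga × Gb → unitaryGroup (Fin χ) ℂ,
      IsBondUnitaries A (fun i g => siteUnitary U a b i.val g) v := by
  have hgauge : ∀ g, ∃ v, IsRingGauge A
      (fun i : Fin L => siteAct (siteUnitary U a b i.val g).1 A) v := fun g => by
    refine hA.exists_isRingGauge (B := fun j => siteAct (siteUnitary U a b j g).1 A)
      (fun j => dualTransfer_siteAct_self _ A) fun k hk => ?_
    obtain ⟨θ, hθ⟩ := hS g k hk
    exact ⟨θ, fun s => (sum_prod_mul_ringState _ (fun _ => A) s).symm.trans (hθ s)⟩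
  choose v hv using hgauge
  exact ⟨fun i g => v g i, isBondUnitaries_iff.2 hv⟩

variable {Ga Gb : Type*} [CommGroup Ga] [CommGroup Gb]

theorem modulation_pow_apply (a b : ℤ) (n : ℕ) (g : Ga × Gb) :
    (modulation Ga Gb a b ^ n) g = (g.1 ^ a ^ n, g.2 ^ b ^ n) := by
  induction n with
  | zero => simp
  | succ n ih =>
    rw [pow_succ', Monoid.End.coe_mul, Function.comp_apply, ih, modulation_apply, pow_succ,
      pow_succ, _root_.zpow_mul, _root_.zpow_mul]

theorem modulation_pow_eq_one (ha : ∀ g : Ga, g ^ a ^ L = g) (hb : ∀ g : Gb, g ^ b ^ L = g) :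
    modulation Ga Gb a b ^ L = 1 :=
  DFunLike.ext _ _ fun g => by
    rw [modulation_pow_apply, ha, hb, Monoid.End.coe_one, id]

theorem siteUnitary_eq_comp_modulation (U : Ga × Gb →* unitaryGroup (Fin d) ℂ) (j : ℕ) :
    siteUnitary U a b j = U.comp (modulation Ga Gb a b ^ j) := by
  funext g
  change siteUnitary U a b j g = U ((modulation Ga Gb a b ^ j) g)
  rw [modulation_pow_apply, siteUnitary, ← map_zpow, ← map_zpow, ← map_mul]
  simp [-Matrix.one_zpow]

variable [NeZero L] {U : Ga × Gb →* unitaryGroup (Fin d) ℂ}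

theorem IsSymmetricMPS.exists_class (hA : IsInjectiveMPS A) (hS : IsSymmetricMPS A U a b L)
    (ha : ∀ g : Ga, g ^ a ^ L = g) (hb : ∀ g : Gb, g ^ b ^ L = g) :
    ∃ c : H2 (Ga × Gb), ∀ v : Fin L → Ga × Gb → unitaryGroup (Fin χ) ℂ,
      IsBondUnitaries A (fun i g => siteUnitary U a b i.val g) v →
      ∀ i, ∃ ω : Z2 (Ga × Gb), IsFactorSystem (v i) ω.1 ∧ H2.mk ω = c ∧
        H2.mk (Z2.pullback (modulation Ga Gb a b) ω) = H2.mk ω := by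
  obtain ⟨u, hu⟩ := hS.exists_isBondUnitaries hA
  simp only [siteUnitary_eq_comp_modulation] at hu ⊢
  obtain ⟨η, hη⟩ := hu.exists_factorSystem hA
    (W := fun i => U.comp (modulation Ga Gb a b ^ i.val)) 0
  refine ⟨H2.mk η, fun v hv i => ?_⟩
  obtain ⟨ω, hω⟩ := hv.exists_factorSystem hA
    (W := fun i => U.comp (modulation Ga Gb a b ^ i.val)) i
  exact ⟨ω, hω, hv.mk_eq_mk hA (W := fun i => U.comp (modulation Ga Gb a b ^ i.val)) hu hω hη,
    hv.mk_pullback_eq hA (modulation_pow_eq_one ha hb) hω⟩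

end ExponentialSymmetries

section MatrixUnitTensor

variable {n : ℕ}

/-- The tensor of normalized matrix units, whose states are products of maximally entangled
pairs. -/
def matrixUnitTensor (n : ℕ) (s : Fin (n * n)) : Matrix (Fin n) (Fin n) ℂ :=
  single (finProdFinEquiv.symm s).1 (finProdFinEquiv.symm s).2 ((√n : ℝ) : ℂ)⁻¹

theorem matrixUnitTensor_finProdFinEquiv (i j : Fin n) :
    matrixUnitTensor n (finProdFinEquiv (i, j)) = single i j ((√n : ℝ) : ℂ)⁻¹ := by
  rw [matrixUnitTensor, Equiv.symm_apply_apply]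

theorem inv_sqrt_natCast_mul_self (n : ℕ) :
    ((√n : ℝ) : ℂ)⁻¹ * ((√n : ℝ) : ℂ)⁻¹ = (n : ℂ)⁻¹ := by
  rw [← mul_inv, ← Complex.ofReal_mul, Real.mul_self_sqrt (Nat.cast_nonneg n),
    Complex.ofReal_natCast]

theorem sum_finProdFinEquiv {M : Type*} [AddCommMonoid M] (f : Fin (n * n) → M) :
    ∑ s, f s = ∑ i, ∑ j, f (finProdFinEquiv (i, j)) := by
  rw [← finProdFinEquiv.sum_comp, Fintype.sum_prod_type]

theorem transferMatrix_matrixUnitTensor (n : ℕ) :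
    transferMatrix (matrixUnitTensor n) = vecMulVec (vec 1) ((n : ℂ)⁻¹ • vec 1) := by
  ext ⟨i, k⟩ ⟨j, l⟩
  simp only [transferMatrix, Matrix.sum_apply, sum_finProdFinEquiv,
    matrixUnitTensor_finProdFinEquiv, kroneckerMap_apply, map_apply, single_apply, vecMulVec_apply,
    vec, Matrix.one_apply, Pi.smul_apply, smul_eq_mul, ite_and]
  rw [← inv_sqrt_natCast_mul_self]
  by_cases hik : i = k <;> by_cases hjl : j = l <;>
    simp [hik, hjl, Ne.symm, eq_comm]

variable [NeZero n]

theorem inv_smul_vec_one_dotProduct_vec_one :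
    ((n : ℂ)⁻¹ • vec (1 : Matrix (Fin n) (Fin n) ℂ)) ⬝ᵥ vec 1 = 1 := by
  rw [smul_dotProduct, vec_dotProduct_vec]
  simp [NeZero.ne n]

theorem isInjectiveMPS_matrixUnitTensor : IsInjectiveMPS (matrixUnitTensor n) where
  left_canonical := by
    simp only [sum_finProdFinEquiv, matrixUnitTensor_finProdFinEquiv, conjTranspose_single,
      single_mul_single_same, Complex.star_def, map_inv₀, Complex.conj_ofReal,
      inv_sqrt_natCast_mul_self]
    rw [Finset.sum_comm]
    ext i j
    simp [Matrix.sum_apply, single_apply, Matrix.one_apply, ite_and, NeZero.ne n]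
  right_fixed := ⟨1, PosDef.one, by
    simp [sum_finProdFinEquiv, matrixUnitTensor_finProdFinEquiv, conjTranspose_single,
      inv_sqrt_natCast_mul_self, sum_single_one]⟩
  unique_dominant := by
    rw [transferMatrix_matrixUnitTensor]
    exact finrank_eigenspace_vecMulVec inv_smul_vec_one_dotProduct_vec_one
  gap := fun μ hμ hμ1 => by
    rw [transferMatrix_matrixUnitTensor] at hμ
    rw [(eigenvalue_vecMulVec_mem inv_smul_vec_one_dotProduct_vec_one hμ).resolve_right hμ1,
      norm_zero]
    exact one_pos

end MatrixUnitTensor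

section ConjTensor

theorem submatrix_mem_unitaryGroup {l m : Type*} [Fintype l] [DecidableEq l] [Fintype m]
    [DecidableEq m] (e : l ≃ m) {V : Matrix m m ℂ} (hV : V ∈ unitaryGroup m ℂ) :
    V.submatrix e e ∈ unitaryGroup l ℂ := by
  rw [mem_unitaryGroup_iff', star_eq_conjTranspose, conjTranspose_submatrix, submatrix_mul_equiv,
    ← star_eq_conjTranspose, mem_unitaryGroup_iff'.1 hV, submatrix_one_equiv]

variable {n : ℕ}

/-- The physical unitary `V* ⊗ W`, which multiplies the matrix units by `V†` and `W`. -/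
def conjTensor (V W : unitaryGroup (Fin n) ℂ) : unitaryGroup (Fin (n * n)) ℂ :=
  ⟨(V.1.map (starRingEnd ℂ) ⊗ₖ W.1).submatrix finProdFinEquiv.symm finProdFinEquiv.symm,
    submatrix_mem_unitaryGroup _ (kronecker_mem_unitary (UnitaryGroup.map_star V).2 W.2)⟩

theorem conjTensor_mul (V V' W W' : unitaryGroup (Fin n) ℂ) :
    conjTensor V W * conjTensor V' W' = conjTensor (V * V') (W * W') := by
  refine Subtype.ext ?_
  simp only [conjTensor, Submonoid.coe_mul, Matrix.map_mul, mul_kronecker_mul,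
    submatrix_mul_equiv]

theorem conjTensor_eq_of_smul {V V' W W' : unitaryGroup (Fin n) ℂ} {z : Circle}
    (hV : V'.1 = (z : ℂ) • V.1) (hW : W'.1 = (z : ℂ) • W.1) :
    conjTensor V' W' = conjTensor V W := by
  have hz : starRingEnd ℂ (z : ℂ) * z = 1 := by rw [Complex.conj_mul', Circle.norm_coe]; simp
  ext s t
  simp only [conjTensor, hV, hW, submatrix_apply, kroneckerMap_apply, map_apply,
    Matrix.smul_apply, smul_eq_mul, map_mul]
  rw [mul_mul_mul_comm, hz, one_mul]

theorem siteAct_conjTensor (V W : unitaryGroup (Fin n) ℂ) (s : Fin (n * n)) :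
    siteAct (conjTensor V W).1 (matrixUnitTensor n) s = V.1ᴴ * matrixUnitTensor n s * W.1 := by
  obtain ⟨⟨i, j⟩, rfl⟩ := finProdFinEquiv.surjective s
  rw [matrix_eq_sum_single (V.1ᴴ * _ * W.1), siteAct, sum_finProdFinEquiv]
  refine Finset.sum_congr rfl fun p _ => Finset.sum_congr rfl fun q _ => ?_
  rw [matrixUnitTensor_finProdFinEquiv, matrixUnitTensor_finProdFinEquiv, smul_single]
  congr 1
  simp [conjTensor, Matrix.mul_apply, single_apply, ite_and]
  ring

end ConjTensor

section ProjectiveBonds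

theorem prod_ofFn_gauge {m : Type*} [Fintype m] [DecidableEq m] (v : ℕ → unitaryGroup m ℂ) {n : ℕ}
    (f : Fin n → Matrix m m ℂ) :
    (List.ofFn fun i : Fin n => (v i).1ᴴ * f i * (v (i + 1)).1).prod
      = (v 0).1ᴴ * (List.ofFn f).prod * (v n).1 := by
  induction n with
  | zero =>
    rw [List.ofFn_zero, List.ofFn_zero, List.prod_nil, Matrix.mul_one]
    exact (Unitary.coe_star_mul_self (v 0)).symm
  | succ n ih =>
    have hv : (v n).1 * (v n).1ᴴ = 1 := Unitary.coe_mul_star_self (v n)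
    rw [List.ofFn_succ', List.ofFn_succ', List.prod_concat, List.prod_concat]
    simp only [Fin.val_castSucc, Fin.val_last, ih fun i => f i.castSucc]
    simp only [Matrix.mul_assoc]
    rw [← Matrix.mul_assoc (v n).1, hv, Matrix.one_mul]

variable {G : Type*} [Group G]

theorem H2.mk_pullback_congr {H : Type*} [Group H] (f : G →* H) {ω η : Z2 H}
    (h : H2.mk ω = H2.mk η) : H2.mk (Z2.pullback f ω) = H2.mk (Z2.pullback f η) := by
  obtain ⟨β, hβ⟩ := H2.mk_eq_mk_iff.1 h
  exact H2.mk_eq_mk_iff.2 ⟨β ∘ f, fun g k => by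
    rw [Function.comp_apply, Function.comp_apply, Function.comp_apply, map_mul]
    exact hβ (f g) (f k)⟩

theorem H2.mk_pullback_pow {τ : Monoid.End G} {ω : Z2 G}
    (h : H2.mk (Z2.pullback τ ω) = H2.mk ω) (n : ℕ) :
    H2.mk (Z2.pullback (τ ^ n) ω) = H2.mk ω := by
  induction n with
  | zero => rfl
  | succ n ih => exact (H2.mk_pullback_congr τ ih).trans h

variable {n : ℕ}

theorem IsFactorSystem.exists_smul {V : G → unitaryGroup (Fin n) ℂ} {η ω : Z2 G}
    (hV : IsFactorSystem V η.1) (h : H2.mk η = H2.mk ω) :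
    ∃ (W : G → unitaryGroup (Fin n) ℂ) (θ : G → Circle),
      IsFactorSystem W ω.1 ∧ ∀ g, (W g).1 = (θ g : ℂ) • (V g).1 := by
  obtain ⟨β, hβ⟩ := H2.mk_eq_mk_iff.1 h
  have hω : ∀ g k, β g * β k * η.1 g k = ω.1 g k * β (g * k) := fun g k =>
    (div_eq_div_iff_mul_eq_mul.1 (hβ g k)).symm
  refine ⟨fun g => ⟨(β g : ℂ) • (V g).1, ?_⟩, β, fun g k => ?_, fun g => rfl⟩
  · refine Unitary.smul_mem_of_mem (Unitary.mem_iff_self_mul_star.2 ?_) (V g).2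
    rw [Complex.star_def, ← Circle.coe_inv_eq_conj, ← Circle.coe_mul, mul_inv_cancel,
      Circle.coe_one]
  · change ((β g : ℂ) • (V g).1) * ((β k : ℂ) • (V k).1) = (ω.1 g k : ℂ) • (β (g * k) : ℂ) • _
    rw [smul_mul_smul_comm, hV g k, smul_smul, smul_smul, ← Circle.coe_mul, ← Circle.coe_mul,
      ← Circle.coe_mul, hω]

theorem exists_monoidHom_eq_conjTensor {V W : G → unitaryGroup (Fin n) ℂ} {ω : G → G → Circle}
    (hV : IsFactorSystem V ω) (hW : IsFactorSystem W ω) :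
    ∃ U : G →* unitaryGroup (Fin (n * n)) ℂ, ∀ g, U g = conjTensor (V g) (W g) :=
  ⟨MonoidHom.mk' _ fun g h => ((conjTensor_mul _ _ _ _).trans
    (conjTensor_eq_of_smul (hV g h) (hW g h))).symm, fun _ => rfl⟩

theorem exists_siteAct_matrixUnitTensor {V : G → unitaryGroup (Fin n) ℂ} {ω : Z2 G} {τ : G →* G}
    (hV : IsFactorSystem V ω.1) (hω : H2.mk (Z2.pullback τ ω) = H2.mk ω) :
    ∃ U : G →* unitaryGroup (Fin (n * n)) ℂ, ∀ g, ∃ θ : Circle, ∀ s,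
      siteAct (U g).1 (matrixUnitTensor n) s
        = (θ : ℂ) • ((V g).1ᴴ * matrixUnitTensor n s * (V (τ g)).1) := by
  obtain ⟨W, θ, hW, hWV⟩ := (hV.comp τ).exists_smul hω
  obtain ⟨U, hU⟩ := exists_monoidHom_eq_conjTensor hV hW
  exact ⟨U, fun g => ⟨θ g, fun s => by
    rw [hU, siteAct_conjTensor, hWV, Matrix.mul_smul]; rfl⟩⟩

end ProjectiveBonds

section Realization

variable {Ga Gb : Type*} [CommGroup Ga] [CommGroup Gb] {a b : ℤ} {L n : ℕ} [NeZero L] [NeZero n]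

theorem isTensorEigenstate_of_gauge {d χ k : ℕ} {A : Fin d → Matrix (Fin χ) (Fin χ) ℂ}
    {W : Fin k → unitaryGroup (Fin d) ℂ} {v : ℕ → unitaryGroup (Fin χ) ℂ} (hv : v k = v 0)
    (h : ∀ i : Fin k, ∃ θ : Circle, ∀ s,
      siteAct (W i).1 A s = (θ : ℂ) • ((v i).1ᴴ * A s * (v (i + 1)).1)) :
    IsTensorEigenstate W (mpsState A k) := by
  choose θ hθ using h
  have hvv : (v 0).1 * (v 0).1ᴴ = 1 := Unitary.coe_mul_star_self (v 0)
  refine ⟨∏ i, θ i, fun s => (sum_prod_mul_ringState _ (fun _ => A) s).trans ?_⟩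
  simp only [ringState, hθ]
  rw [prod_ofFn_smul, prod_ofFn_gauge, hv, trace_smul, trace_mul_cycle, hvv, Matrix.one_mul]
  exact congrArg (· * _) (map_prod Circle.coeHom θ _).symm

theorem H2.mk_mem_sptClasses {V : Ga × Gb → unitaryGroup (Fin n) ℂ} {ω : Z2 (Ga × Gb)}
    (hV : IsFactorSystem V ω.1) (hτ : modulation Ga Gb a b ^ L = 1)
    (hω : H2.mk (Z2.pullback (modulation Ga Gb a b) ω) = H2.mk ω) :
    H2.mk ω ∈ sptClasses Ga Gb a b L := by
  set τ := modulation Ga Gb a b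
  obtain ⟨U, hU⟩ := exists_siteAct_matrixUnitTensor hV hω
  have hsite : ∀ (j : ℕ) (g : Ga × Gb), ∃ θ : Circle, ∀ s,
      siteAct (siteUnitary U a b j g).1 (matrixUnitTensor n) s
        = (θ : ℂ) • ((V ((τ ^ j) g)).1ᴴ * matrixUnitTensor n s * (V ((τ ^ (j + 1)) g)).1) :=
    fun j g => by
      rw [siteUnitary_eq_comp_modulation, pow_succ']
      exact hU _
  refine ⟨n * n, n, matrixUnitTensor n, U, isInjectiveMPS_matrixUnitTensor, fun g k _ => ?_,
    fun i => V ∘ ⇑(τ ^ i.val), fun i g => ?_,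
    fun i => ⟨_, hV.comp (τ ^ i.val), H2.mk_pullback_pow hω _⟩⟩
  · refine isTensorEigenstate_of_gauge (v := fun j => V ((τ ^ j) g)) ?_ fun i => ?_
    · rw [mul_comm, pow_mul, hτ, one_pow, pow_zero]
    · obtain ⟨θ, hθ⟩ := hsite (i % L) g
      refine ⟨θ, fun s => ?_⟩
      rw [hθ, pow_succ, pow_succ, ← pow_eq_pow_mod _ hτ]
  · simp only [Function.comp_apply, pow_val_add_one hτ, ← pow_succ]
    exact hsite i g

theorem H2.mk_mem_sptClasses_iff (ha : ∀ g : Ga, g ^ a ^ L = g) (hb : ∀ g : Gb, g ^ b ^ L = g)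
    {ω : Z2 (Ga × Gb)} :
    H2.mk ω ∈ sptClasses Ga Gb a b L ↔
      (∃ (n : ℕ) (_ : NeZero n) (V : Ga × Gb → unitaryGroup (Fin n) ℂ), IsFactorSystem V ω.1) ∧
        H2.mk (Z2.pullback (modulation Ga Gb a b) ω) = H2.mk ω := by
  have hτ := modulation_pow_eq_one ha hb
  refine ⟨?_, fun ⟨⟨n, _, V, hV⟩, hω⟩ => H2.mk_mem_sptClasses hV hτ hω⟩
  rintro ⟨d, χ, A, U, hA, -, v, hv, hc⟩
  have := hA.nonempty
  obtain ⟨η, hη, hηω⟩ := hc 0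
  obtain ⟨V, -, hV, -⟩ := hη.exists_smul hηω
  simp only [siteUnitary_eq_comp_modulation] at hv
  refine ⟨⟨χ, ⟨by rintro rfl; exact isEmptyElim (Classical.arbitrary (Fin 0))⟩, V, hV⟩, ?_⟩
  rw [H2.mk_pullback_congr (modulation Ga Gb a b) hηω.symm, ← hηω]
  exact hv.mk_pullback_eq hA hτ hη

end Realization

section CyclicGroups

theorem Z2_le_B2_of_isCyclic (G : Type*) [CommGroup G] [IsCyclic G] : Z2 G ≤ B2 G := by
  intro ω hω
  refine mem_B2_of_symm (ω := ⟨ω, hω⟩) fun g h => ?_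
  obtain ⟨x, hx⟩ := IsCyclic.exists_generator (α := G)
  obtain ⟨m, rfl⟩ := hx g
  obtain ⟨n, rfl⟩ := hx h
  refine div_eq_one.1 ((commutatorPairing_apply ⟨ω, hω⟩ (x ^ m) (x ^ n)).symm.trans ?_)
  rw [map_zpow, map_zpow, MonoidHom.zpow_apply, commutatorPairing_apply, div_self', _root_.one_zpow,
    _root_.one_zpow]

theorem commutatorPairing_eq_one_of_isCyclic {G : Type*} [CommGroup G] [IsCyclic G] (ω : Z2 G) :
    commutatorPairing ω = 1 :=
  mem_B2_iff_commutatorPairing_eq_one.1 (Z2_le_B2_of_isCyclic G ω.2)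

variable {Ga Gb : Type*} [CommGroup Ga] [CommGroup Gb] [IsCyclic Ga] [IsCyclic Gb]

theorem commutatorPairing_eq_mixedPhase_div (ω : Z2 (Ga × Gb)) (g h : Ga × Gb) :
    commutatorPairing ω g h = mixedPhase ω.1 g.1 h.2 / mixedPhase ω.1 h.1 g.2 := by
  have hsectorA : commutatorPairing ω (g.1, 1) (h.1, 1) = 1 :=
    DFunLike.congr_fun (DFunLike.congr_fun (commutatorPairing_eq_one_of_isCyclic
      (Z2.pullback (MonoidHom.inl Ga Gb) ω)) g.1) h.1
  have hsectorB : commutatorPairing ω (1, g.2) (1, h.2) = 1 :=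
    DFunLike.congr_fun (DFunLike.congr_fun (commutatorPairing_eq_one_of_isCyclic
      (Z2.pullback (MonoidHom.inr Ga Gb) ω)) g.2) h.2
  rw [commutatorPairing_prod, hsectorA, hsectorB, mul_one, mul_one]

theorem H2.mk_eq_mk_iff_mixedPhase {ω η : Z2 (Ga × Gb)} :
    H2.mk ω = H2.mk η ↔ ∀ ga gb, mixedPhase ω.1 ga gb = mixedPhase η.1 ga gb := by
  rw [H2.mk_eq_mk_iff_commutatorPairing]
  refine ⟨fun h ga gb => DFunLike.congr_fun (DFunLike.congr_fun h (ga, 1)) (1, gb), fun h => ?_⟩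
  ext g k : 2
  rw [commutatorPairing_eq_mixedPhase_div, commutatorPairing_eq_mixedPhase_div, h, h]

theorem H2.mk_zpow_eq_one_iff_mixedPhase {ω : Z2 (Ga × Gb)} {n : ℤ} :
    H2.mk ω ^ n = 1 ↔ ∀ ga gb, mixedPhase ω.1 ga gb ^ n = 1 := by
  change H2.mk (ω ^ n) = H2.mk 1 ↔ _
  rw [H2.mk_eq_mk_iff_mixedPhase]
  simp only [mixedPhase_eq_commutatorPairing, map_zpow, MonoidHom.zpow_apply, map_one,
    MonoidHom.one_apply]

theorem H2.mk_pullback_modulation_eq_iff {a b : ℤ} {ω : Z2 (Ga × Gb)} :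
    H2.mk (Z2.pullback (modulation Ga Gb a b) ω) = H2.mk ω ↔ H2.mk ω ^ (a * b - 1) = 1 := by
  rw [H2.mk_zpow_eq_one_iff_mixedPhase]
  refine ⟨mixedPhase_zpow_eq_one, fun h => H2.mk_eq_mk_iff_mixedPhase.2 fun ga gb => ?_⟩
  calc mixedPhase (Z2.pullback (modulation Ga Gb a b) ω).1 ga gb
      = commutatorPairing ω (ga ^ a, 1 ^ b) (1 ^ a, gb ^ b) := rfl
    _ = mixedPhase ω.1 (ga ^ a) (gb ^ b) := by
      rw [_root_.one_zpow, _root_.one_zpow, mixedPhase_eq_commutatorPairing]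
    _ = mixedPhase ω.1 ga gb ^ (a * b - 1 + 1) := by rw [mixedPhase_zpow_zpow, sub_add_cancel]
    _ = mixedPhase ω.1 ga gb := by rw [_root_.zpow_add_one, h, one_mul]

end CyclicGroups

section ProductOfCyclicGroups

variable {N : ℕ} [NeZero N]

theorem exists_toCircle_eq {z : Circle} (hz : z ^ N = 1) : ∃ k : ZMod N, ZMod.toCircle k = z := by
  obtain ⟨k, hk⟩ := (bijective_rootsOfUnityAddChar N).2 (rootsOfUnity.mkOfPowEq z hz)
  exact ⟨k, (ZMod.rootsOfUnityAddChar_val N k).symm.trans (by rw [hk, rootsOfUnity.coe_mkOfPowEq])⟩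

theorem mixedPhase_eq_toCircle (ω : Z2 (Multiplicative (ZMod N) × Multiplicative (ZMod N))) :
    ∃ k : ZMod N, ∀ ga gb : Multiplicative (ZMod N),
      mixedPhase ω.1 ga gb = ZMod.toCircle (k * ga.toAdd * gb.toAdd) := by
  let t : Multiplicative (ZMod N) := Multiplicative.ofAdd 1
  have hpow : ∀ g : Multiplicative (ZMod N), g = t ^ (g.toAdd.val : ℤ) := fun g => by
    rw [← ofAdd_zsmul, natCast_zsmul, nsmul_one, ZMod.natCast_zmod_val, ofAdd_toAdd]
  have htN : t ^ (N : ℤ) = 1 := by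
    rw [← ofAdd_zsmul, natCast_zsmul, nsmul_one, CharP.cast_eq_zero, ofAdd_zero]
  have hroot : mixedPhase ω.1 t t ^ N = 1 := by
    have h := mixedPhase_zpow_zpow ω N 1 t t
    rw [htN, mul_one, zpow_natCast, _root_.zpow_one] at h
    rw [← h, mixedPhase_eq_commutatorPairing, Prod.mk_one_one, map_one, MonoidHom.one_apply]
  obtain ⟨k, hk⟩ := exists_toCircle_eq hroot
  refine ⟨k, fun ga gb => ?_⟩
  conv_lhs => rw [hpow ga, hpow gb]
  rw [mixedPhase_zpow_zpow, ← hk, ← AddChar.map_zsmul_eq_zpow, zsmul_eq_mul]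
  congr 1
  push_cast
  rw [ZMod.natCast_zmod_val, ZMod.natCast_zmod_val]
  ring

/-- The 2-cocycle `exp(-2πi k g_b h_a / N)` on `ℤ_N × ℤ_N`, whose mixed phase is
`exp(2πi k g_a g_b / N)`. -/
def mixedCocycle (k : ZMod N) : Z2 (Multiplicative (ZMod N) × Multiplicative (ZMod N)) :=
  ⟨fun g h => ZMod.toCircle (-(k * g.2.toAdd * h.1.toAdd)), fun g h l => by
    simp only [← AddChar.map_add_eq_mul, Prod.fst_mul, Prod.snd_mul, toAdd_mul]
    congr 1
    ring⟩

theorem mixedCocycle_apply (k : ZMod N) (g h : Multiplicative (ZMod N) × Multiplicative (ZMod N)) :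
    (mixedCocycle k).1 g h = ZMod.toCircle (-(k * g.2.toAdd * h.1.toAdd)) := rfl

theorem mixedPhase_mixedCocycle (k : ZMod N) (ga gb : Multiplicative (ZMod N)) :
    mixedPhase (mixedCocycle k).1 ga gb = ZMod.toCircle (k * ga.toAdd * gb.toAdd) := by
  simp [mixedPhase, mixedCocycle_apply, AddChar.map_neg_eq_inv, mul_right_comm]

variable (N) in
/-- The homomorphism `ℤ_N → H²(ℤ_N × ℤ_N, U(1))` taking `k` to the class of `mixedCocycle k`. -/
def mixedClass :
    Multiplicative (ZMod N) →* H2 (Multiplicative (ZMod N) × Multiplicative (ZMod N)) :=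
  MonoidHom.mk' (fun k => H2.mk (mixedCocycle k.toAdd)) fun k l => by
    refine (congrArg H2.mk (Subtype.ext ?_) :
      H2.mk _ = H2.mk (mixedCocycle k.toAdd * mixedCocycle l.toAdd))
    funext g h
    simp only [Subgroup.coe_mul, Pi.mul_apply, mixedCocycle_apply, ← AddChar.map_add_eq_mul,
      toAdd_mul]
    congr 1
    ring

variable (N) in
theorem mixedClass_bijective : Function.Bijective (mixedClass N) := by
  constructor
  · intro k l h
    have hphase := H2.mk_eq_mk_iff_mixedPhase.1 h (Multiplicative.ofAdd 1) (Multiplicative.ofAdd 1)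
    rw [mixedPhase_mixedCocycle, mixedPhase_mixedCocycle] at hphase
    rw [toAdd_ofAdd, mul_one, mul_one, mul_one, mul_one] at hphase
    exact Multiplicative.toAdd.injective (ZMod.injective_toCircle hphase)
  · intro c
    obtain ⟨ω, rfl⟩ := QuotientGroup.mk_surjective c
    obtain ⟨k, hk⟩ := mixedPhase_eq_toCircle ω
    refine ⟨Multiplicative.ofAdd k, H2.mk_eq_mk_iff_mixedPhase.2 fun ga gb => ?_⟩
    rw [mixedPhase_mixedCocycle, toAdd_ofAdd, hk]

variable (N) in
/-- The isomorphism `H²(ℤ_N × ℤ_N, U(1)) ≅ ℤ_N`, `[ω] ↦ k`, for which the mixed phase of `ω` is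
`exp(2πi k g_a g_b / N)`. -/
def classEquiv :
    H2 (Multiplicative (ZMod N) × Multiplicative (ZMod N)) ≃* Multiplicative (ZMod N) :=
  (MulEquiv.ofBijective (mixedClass N) (mixedClass_bijective N)).symm

theorem mk_mixedCocycle_classEquiv (c : H2 (Multiplicative (ZMod N) × Multiplicative (ZMod N))) :
    H2.mk (mixedCocycle (classEquiv N c).toAdd) = c :=
  (MulEquiv.ofBijective (mixedClass N) (mixedClass_bijective N)).apply_symm_apply c

theorem mixedPhase_eq_classEquiv (ω : Z2 (Multiplicative (ZMod N) × Multiplicative (ZMod N)))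
    (ga gb : Multiplicative (ZMod N)) :
    mixedPhase ω.1 ga gb
      = ZMod.toCircle ((classEquiv N (H2.mk ω)).toAdd * ga.toAdd * gb.toAdd) := by
  rw [← mixedPhase_mixedCocycle]
  exact H2.mk_eq_mk_iff_mixedPhase.1 (mk_mixedCocycle_classEquiv (H2.mk ω)).symm ga gb

end ProductOfCyclicGroups

section WeylMatrices

variable {N : ℕ} [NeZero N]

/-- The generalized Pauli matrices `X ^ g_a * Z ^ (k g_b)`, with `X` the shift and `Z` the clock
matrix: up to a choice of basis, the projective representation of `ℤ_N × ℤ_N` with factor system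
`mixedCocycle k`. -/
def weylMatrix (k : ZMod N) (g : Multiplicative (ZMod N) × Multiplicative (ZMod N)) :
    Matrix (ZMod N) (ZMod N) ℂ :=
  of fun p q => if q = p + g.1.toAdd then (ZMod.toCircle (k * g.2.toAdd * q) : ℂ) else 0

theorem weylMatrix_mul (k : ZMod N) (g h : Multiplicative (ZMod N) × Multiplicative (ZMod N)) :
    weylMatrix k g * weylMatrix k h = ((mixedCocycle k).1 g h : ℂ) • weylMatrix k (g * h) := by
  ext p r
  simp only [weylMatrix, mul_apply, of_apply, Matrix.smul_apply, smul_eq_mul, ite_mul, zero_mul,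
    Finset.sum_ite_eq', Finset.mem_univ, if_true, Prod.fst_mul, Prod.snd_mul, toAdd_mul,
    ← add_assoc, mixedCocycle_apply]
  rw [mul_ite, mul_ite, mul_zero, mul_zero]
  split_ifs with hr
  · rw [hr, ← Circle.coe_mul, ← Circle.coe_mul, ← AddChar.map_add_eq_mul, ← AddChar.map_add_eq_mul]
    congr 2
    ring
  · rfl

theorem weylMatrix_mul_conjTranspose (k : ZMod N)
    (g : Multiplicative (ZMod N) × Multiplicative (ZMod N)) :
    weylMatrix k g * (weylMatrix k g)ᴴ = 1 := by
  ext p r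
  simp only [weylMatrix, mul_apply, conjTranspose_apply, of_apply, one_apply, ite_mul, zero_mul,
    Finset.sum_ite_eq', Finset.mem_univ, if_true, add_left_inj, apply_ite star, star_zero, mul_ite,
    mul_zero]
  exact if_congr eq_comm ((Complex.mul_conj _).trans (by simp)) rfl

/-- The matrices `weylMatrix k`, indexed by `Fin N`. -/
def weylUnitary (k : ZMod N) (g : Multiplicative (ZMod N) × Multiplicative (ZMod N)) :
    unitaryGroup (Fin N) ℂ :=
  ⟨_, submatrix_mem_unitaryGroup (ZMod.finEquiv N).toEquiv
    (mem_unitaryGroup_iff.2 (weylMatrix_mul_conjTranspose k g))⟩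

theorem isFactorSystem_weylUnitary (k : ZMod N) :
    IsFactorSystem (weylUnitary k) (mixedCocycle k).1 := fun g h => by
  simp only [weylUnitary, submatrix_mul_equiv, weylMatrix_mul, submatrix_smul, Pi.smul_apply]

end WeylMatrices

section CyclicClassification

variable {N : ℕ} [NeZero N] {a b : ℤ} {L : ℕ} [NeZero L]

theorem mem_sptClasses_iff_zpow_eq_one (ha : ∀ g : Multiplicative (ZMod N), g ^ a ^ L = g)
    (hb : ∀ g : Multiplicative (ZMod N), g ^ b ^ L = g)
    {c : H2 (Multiplicative (ZMod N) × Multiplicative (ZMod N))} :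
    c ∈ sptClasses (Multiplicative (ZMod N)) (Multiplicative (ZMod N)) a b L
      ↔ c ^ (a * b - 1) = 1 := by
  rw [← mk_mixedCocycle_classEquiv c, H2.mk_mem_sptClasses_iff ha hb,
    H2.mk_pullback_modulation_eq_iff]
  exact and_iff_right ⟨N, inferInstance, _, isFactorSystem_weylUnitary _⟩

theorem ofAdd_zpow_eq_one_iff_div_gcd_dvd (k : ZMod N) (n : ℤ) :
    Multiplicative.ofAdd k ^ n = 1 ↔ N / Int.gcd n N ∣ k.val := by
  have hdvd : Multiplicative.ofAdd k ^ n = 1 ↔ N ∣ n.natAbs * k.val := by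
    rw [← pow_natAbs_eq_one, ← ofAdd_nsmul, ofAdd_eq_one, nsmul_eq_mul, ← ZMod.natCast_eq_zero_iff,
      Nat.cast_mul, ZMod.natCast_zmod_val]
  rw [hdvd, Int.gcd_eq_natAbs_gcd_natAbs, Int.natAbs_natCast, Nat.gcd_comm,
    Nat.div_dvd_iff_dvd_mul (Nat.gcd_dvd_left _ _) (Nat.gcd_pos_of_pos_left _ (NeZero.pos N)),
    Nat.dvd_gcd_mul_iff_dvd_mul]

theorem exists_subgroup_mem_iff_zpow_eq_one {H : Type*} [CommGroup H]
    (e : H ≃* Multiplicative (ZMod N)) (n : ℤ) :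
    ∃ S : Subgroup H, (∀ c, c ∈ S ↔ c ^ n = 1) ∧
      Nonempty (S ≃* Multiplicative (ZMod (Int.gcd n N))) := by
  have : IsCyclic H := isCyclic_of_injective e.toMonoidHom e.injective
  have : Finite H := Finite.of_equiv _ e.toEquiv.symm
  refine ⟨(powMonoidHom n.natAbs : H →* H).ker, fun c => pow_natAbs_eq_one,
    ⟨mulEquivOfCyclicCardEq ?_⟩⟩
  rw [IsCyclic.card_powMonoidHom_ker, Nat.card_congr (e.toEquiv.trans Multiplicative.toAdd),
    Nat.card_congr Multiplicative.toAdd, Nat.card_zmod, Nat.card_zmod,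
    Int.gcd_eq_natAbs_gcd_natAbs, Int.natAbs_natCast, Nat.gcd_comm]

end CyclicClassification

end ModulatedMPS

end

open ModulatedMPS in
theorem mainTheorem5_general :
    (∀ (Ga : Type*) (Gb : Type*) [CommGroup Ga] [CommGroup Gb] (a b : ℤ) (L : ℕ) [NeZero L],
      (∀ g : Ga, g ^ (a ^ L) = g) → (∀ g : Gb, g ^ (b ^ L) = g) →
      ∀ (d χ : ℕ) (A : Fin d → Matrix (Fin χ) (Fin χ) ℂ)
        (U : Ga × Gb →* Matrix.unitaryGroup (Fin d) ℂ),
        IsInjectiveMPS A → IsSymmetricMPS A U a b L →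
        (∃ v : Fin L → Ga × Gb → Matrix.unitaryGroup (Fin χ) ℂ,
          IsBondUnitaries A (fun i g => siteUnitary U a b i.val g) v) ∧
        ∃ c : H2 (Ga × Gb), ∀ v : Fin L → Ga × Gb → Matrix.unitaryGroup (Fin χ) ℂ,
          IsBondUnitaries A (fun i g => siteUnitary U a b i.val g) v →
          ∀ i, ∃ ω : Z2 (Ga × Gb), IsFactorSystem (v i) ω.1 ∧ H2.mk ω = c ∧
            sectorA ω.1 ^ (a ^ 2 - 1) ∈ B2 Ga ∧
            sectorMixed ω.1 ^ (a * b - 1) ∈ B2 (Ga × Gb) ∧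
            (∀ ga gb, mixedPhase ω.1 ga gb ^ (a * b - 1) = 1) ∧
            sectorB ω.1 ^ (b ^ 2 - 1) ∈ B2 Gb) ∧
    (∀ (N : ℕ) [NeZero N] (a b : ℤ) (L : ℕ) [NeZero L],
      (∀ g : Multiplicative (ZMod N), g ^ (a ^ L) = g) →
      (∀ g : Multiplicative (ZMod N), g ^ (b ^ L) = g) →
      Z2 (Multiplicative (ZMod N)) ≤ B2 (Multiplicative (ZMod N)) ∧
      ∃ κ : H2 (Multiplicative (ZMod N) × Multiplicative (ZMod N)) ≃* Multiplicative (ZMod N),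
        (∀ (ω : Z2 (Multiplicative (ZMod N) × Multiplicative (ZMod N))) (x y : ZMod N),
          (mixedPhase ω.1 (Multiplicative.ofAdd x) (Multiplicative.ofAdd y) : ℂ)
            = Complex.exp (2 * Real.pi * Complex.I
                * ((Multiplicative.toAdd (κ (H2.mk ω))).val * x.val * y.val : ℕ) / N)) ∧
        (∀ c, c ∈ sptClasses (Multiplicative (ZMod N)) (Multiplicative (ZMod N)) a b L ↔
          N / Int.gcd (a * b - 1) N ∣ (Multiplicative.toAdd (κ c)).val) ∧
        ∃ S : Subgroup (H2 (Multiplicative (ZMod N) × Multiplicative (ZMod N))),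
          (S : Set _) = sptClasses (Multiplicative (ZMod N)) (Multiplicative (ZMod N)) a b L ∧
          Nonempty (S ≃* Multiplicative (ZMod (Int.gcd (a * b - 1) N)))) := by
  refine ⟨fun Ga Gb _ _ a b L _ ha hb d χ A U hA hS => ⟨hS.exists_isBondUnitaries hA, ?_⟩,
    fun N _ a b L _ ha hb =>
      ⟨Z2_le_B2_of_isCyclic _, classEquiv N, fun ω x y => ?_, fun c => ?_, ?_⟩⟩
  · obtain ⟨c, hc⟩ := hS.exists_class hA ha hb
    refine ⟨c, fun v hv i => ?_⟩
    obtain ⟨ω, hω, rfl, hinv⟩ := hc v hv i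
    exact ⟨ω, hω, rfl, sectorA_zpow_mem_B2 hinv, sectorMixed_zpow_mem_B2 hinv,
      mixedPhase_zpow_eq_one hinv, sectorB_zpow_mem_B2 hinv⟩
  · rw [mixedPhase_eq_classEquiv, ← ZMod.toCircle_natCast]
    simp only [toAdd_ofAdd, Nat.cast_mul, ZMod.natCast_zmod_val]
  · rw [mem_sptClasses_iff_zpow_eq_one ha hb, ← ofAdd_zpow_eq_one_iff_div_gcd_dvd, ofAdd_toAdd,
      ← map_zpow, EmbeddingLike.map_eq_one_iff]
  · obtain ⟨S, hS, e⟩ := exists_subgroup_mem_iff_zpow_eq_one (classEquiv N) (a * b - 1)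
    exact ⟨S, Set.ext fun c => (hS c).trans (mem_sptClasses_iff_zpow_eq_one ha hb).symm, e⟩

open ModulatedMPS in
theorem mainTheorem5 :
    -- the cocycle constraints for two exponential symmetries with exponents `a` and `b`
    (∀ (Ga : Type*) (Gb : Type*) [CommGroup Ga] [CommGroup Gb] (a b : ℤ) (L : ℕ) [NeZero L],
      (∀ g : Ga, g ^ (a ^ L) = g) → (∀ g : Gb, g ^ (b ^ L) = g) →
      ∀ (d χ : ℕ) (A : Fin d → Matrix (Fin χ) (Fin χ) ℂ)
        (U : Ga × Gb →* Matrix.unitaryGroup (Fin d) ℂ),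
        IsInjectiveMPS A → IsSymmetricMPS A U a b L →
        (∃ v : Fin L → Ga × Gb → Matrix.unitaryGroup (Fin χ) ℂ,
          IsBondUnitaries A (fun i g => siteUnitary U a b i.val g) v) ∧
        ∃ c : H2 (Ga × Gb), ∀ v : Fin L → Ga × Gb → Matrix.unitaryGroup (Fin χ) ℂ,
          IsBondUnitaries A (fun i g => siteUnitary U a b i.val g) v →
          ∀ i, ∃ ω : Z2 (Ga × Gb), IsFactorSystem (v i) ω.1 ∧ H2.mk ω = c ∧
            sectorA ω.1 ^ (a ^ 2 - 1) ∈ B2 Ga ∧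
            sectorMixed ω.1 ^ (a * b - 1) ∈ B2 (Ga × Gb) ∧
            (∀ ga gb, mixedPhase ω.1 ga gb ^ (a * b - 1) = 1) ∧
            sectorB ω.1 ^ (b ^ 2 - 1) ∈ B2 Gb) ∧
    -- the classification for `Ga = Gb = ℤ_N` and `a = 1`
    (∀ (N : ℕ) [NeZero N] (b : ℤ) (L : ℕ) [NeZero L],
      (∀ g : Multiplicative (ZMod N), g ^ (b ^ L) = g) →
      Z2 (Multiplicative (ZMod N)) ≤ B2 (Multiplicative (ZMod N)) ∧
      ∃ κ : H2 (Multiplicative (ZMod N) × Multiplicative (ZMod N)) ≃* Multiplicative (ZMod N),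
        (∀ (ω : Z2 (Multiplicative (ZMod N) × Multiplicative (ZMod N))) (x y : ZMod N),
          (mixedPhase ω.1 (Multiplicative.ofAdd x) (Multiplicative.ofAdd y) : ℂ)
            = Complex.exp (2 * Real.pi * Complex.I
                * ((Multiplicative.toAdd (κ (H2.mk ω))).val * x.val * y.val : ℕ) / N)) ∧
        (∀ c, c ∈ sptClasses (Multiplicative (ZMod N)) (Multiplicative (ZMod N)) 1 b L ↔
          N / Int.gcd (b - 1) N ∣ (Multiplicative.toAdd (κ c)).val) ∧
        ∃ S : Subgroup (H2 (Multiplicative (ZMod N) × Multiplicative (ZMod N))),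
          (S : Set _) = sptClasses (Multiplicative (ZMod N)) (Multiplicative (ZMod N)) 1 b L ∧
          Nonempty (S ≃* Multiplicative (ZMod (Int.gcd (b - 1) N)))) := by
  refine ⟨mainTheorem5_general.1, fun N _ b L _ hb => ?_⟩
  have hcharge := mainTheorem5_general.{0, 0}.2 N 1 b L (fun g => by rw [one_pow, zpow_one]) hb
  rwa [one_mul] at hcharge
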